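/- Fix an integer $r\ge 2$, let $\mu\in\mathbb R$, $\sigma^2_u\ge 0$, $\sigma^2_\epsilon>0$, and consider the balanced one-way random effects model $$Y_{ij}=\mu+U_i+\epsilon_{ij},\qquad i=1,2,\dots,\quad j=1,\dots,r,$$ where the $U_i$ are identically distributed, the $\epsilon_{ij}$ are identically distributed, and all these random variables are independent. For data $y=(y_{ij})_{i\le a,\,j\le r}$ from $a$ units, with $\bar y_{i\cdot}=\frac1r\sum_j y_{ij}$ and $\bar y_{\cdot\cdot}=\frac1{ar}\sum_{i,j}y_{ij}$, let $$\mathcal L(m,s,t)=(2\pi)^{-\frac{ar}{2}}\,t^{-\frac{a(r-1)}{2}}(t+rs)^{-\frac a2}\exp\Big\{-\frac{\sum_{i,j}(y_{ij}-\bar y_{i\cdot})^2}{2t}-\frac{\sum_{i,j}(\bar y_{i\cdot}-\bar y_{\cdot\cdot})^2}{2(t+rs)}-\frac{ar\,(m-\bar y_{\cdot\cdot})^2}{2(t+rs)}\Big\}$$ be the Gaussian likelihood of $(\mu,\sigma^2_u,\sigma^2_\epsilon)=(m,s,t)$ on the parameter space $m\in\mathbb R$, $s\ge0$, $t>0$.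 For each $a$, let $(\widehat\mu,\widehat{\sigma^2_u},\widehat{\sigma^2_\epsilon})$ be a maximum likelihood estimator, i.e. a function of the data from the first $a$ units whose value maximizes $\mathcal L$ over the parameter space whenever a maximizer exists (with arbitrary values otherwise). Then, as $a\to\infty$ with $r$ fixed: (a) If $\mathrm E[\epsilon_{ij}^2]<\infty$ and $\mathrm{Var}(\epsilon_{ij})=\sigma^2_\epsilon$, then $\widehat{\sigma^2_\epsilon}\to\sigma^2_\epsilon$ almost surely. (b) If $\mathrm E[U_i^2]<\infty$, $\mathrm E[\epsilon_{ij}^2]<\infty$, $\mathrm{Var}(U_i)=\sigma^2_u$ and $\mathrm{Var}(\epsilon_{ij})=\sigma^2_\epsilon$, then $\widehat{\sigma^2_u}\to\sigma^2_u$ almost surely. (c) If $U_i\sim\mathcal N(0,\sigma^2_u)$, $\epsilon_{ij}\sim\mathcal N(0,\sigma^2_\epsilon)$ and $\sigma^2_u>0$, then $$\sqrt a\begin{pmatrix}\widehat{\sigma^2_\epsilon}-\sigma^2_\epsilon\\ \widehat{\sigma^2_u}-\sigma^2_u\end{pmatrix}\xrightarrow{\ d\ }\mathcal N\left(\mathbf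 0,\begin{pmatrix}\sigma_{11}&\sigma_{12}\\ \sigma_{12}&\sigma_{22}\end{pmatrix}\right),$$ where $$\sigma_{11}=\frac{2\sigma^4_\epsilon}{r-1},\qquad \sigma_{12}=\frac{-2\sigma^4_\epsilon}{r(r-1)},\qquad \sigma_{22}=2\Big(\sigma^2_u+\frac{\sigma^2_\epsilon}{r}\Big)^2+\frac{2\sigma^4_\epsilon}{r^2(r-1)}.$$ -/

import Mathlib

open MeasureTheory ProbabilityTheory Filter
open scoped Topology NNReal

noncomputable section

namespace OneWay

/-- The parameter `θ = (μ, σ²_u, σ²_ε)` of the balanced one-way random effects model. -/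
structure Params where
  /-- the general mean -/
  mu : ℝ
  /-- the variance component of the units -/
  varU : ℝ
  /-- the variance component of the measurement errors -/
  varE : ℝ

/-- The parameter space: `μ ∈ ℝ`, `σ²_u ≥ 0`, `σ²_ε > 0`. -/
def paramSpace : Set Params := {θ | 0 ≤ θ.varU ∧ 0 < θ.varE}

/-- The mean `ȳ_{i·}` of the measurements of unit `i`. -/
def unitMean {a r : ℕ} (y : Fin a → Fin r → ℝ) (i : Fin a) : ℝ :=
  (∑ j, y i j) / r

/-- The overall mean `ȳ_{··}`. -/
def grandMean {a r : ℕ} (y : Fin a → Fin r → ℝ) : ℝ :=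
  (∑ i, ∑ j, y i j) / ((a : ℝ) * r)

/-- The Gaussian likelihood of the data `y` at `θ`, that is, the density at `y` of the array
`Y i j = μ + U i + ε i j` with independent `U i ∼ N(0, σ²_u)` and `ε i j ∼ N(0, σ²_ε)`. -/
def likelihood {a r : ℕ} (y : Fin a → Fin r → ℝ) (θ : Params) : ℝ :=
  (2 * Real.pi) ^ (-((a : ℝ) * r) / 2)
    * θ.varE ^ (-((a : ℝ) * ((r : ℝ) - 1)) / 2)
    * (θ.varE + r * θ.varU) ^ (-(a : ℝ) / 2)
    * Real.exp
      (-(∑ i, ∑ j, (y i j - unitMean y i) ^ 2) / (2 * θ.varE)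
        - (∑ i, ∑ _j : Fin r, (unitMean y i - grandMean y) ^ 2) / (2 * (θ.varE + r * θ.varU))
        - (a : ℝ) * r * (θ.mu - grandMean y) ^ 2 / (2 * (θ.varE + r * θ.varU)))

/-- `θ` is a maximum likelihood estimate for the data `y`. -/
def IsMLEstimate {a r : ℕ} (y : Fin a → Fin r → ℝ) (θ : Params) : Prop :=
  θ ∈ paramSpace ∧ IsMaxOn (likelihood y) paramSpace θ

/-- `T` is a maximum likelihood estimator: its value is a maximum likelihood estimate for all data
for which there is one. (If all measurements agree within each unit, the likelihood is unbounded
and there is none; nothing is required of `T` there.) -/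
def IsMLEstimator {a r : ℕ} (T : (Fin a → Fin r → ℝ) → Params) : Prop :=
  ∀ y : Fin a → Fin r → ℝ, (∃ θ, IsMLEstimate y θ) → IsMLEstimate y (T y)

/-- The measurements `Y i j = μ + U i + ε i j` of the first `a` units. -/
def sample {Ω : Type*} {r : ℕ} (μ : ℝ) (U : ℕ → Ω → ℝ) (ε : ℕ → Fin r → Ω → ℝ)
    (a : ℕ) (ω : Ω) : Fin a → Fin r → ℝ :=
  fun i j => μ + U i ω + ε i j ω

/-- The random effects `U i` are identically distributed, so are the errors `ε i j`, and all of
these random variables together are independent. -/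
structure IsRandomEffects {Ω : Type*} [MeasurableSpace Ω] {r : ℕ} (P : Measure Ω)
    (U : ℕ → Ω → ℝ) (ε : ℕ → Fin r → Ω → ℝ) : Prop where
  measurable_U : ∀ i, Measurable (U i)
  measurable_ε : ∀ i j, Measurable (ε i j)
  identDistrib_U : ∀ i i', IdentDistrib (U i) (U i') P P
  identDistrib_ε : ∀ i j i' j', IdentDistrib (ε i j) (ε i' j') P P
  indep : iIndepFun (Sum.elim U (fun p : ℕ × Fin r => ε p.1 p.2)) P

/-- The asymptotic covariance matrix of the estimators of `(σ²_ε, σ²_u)`; `vu` and `ve` are the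
true values of `σ²_u` and `σ²_ε`. -/
def asympCov (r : ℕ) (vu ve : ℝ) : Matrix (Fin 2) (Fin 2) ℝ :=
  !![2 * ve ^ 2 / ((r : ℝ) - 1),
      -2 * ve ^ 2 / ((r : ℝ) * ((r : ℝ) - 1));
     -2 * ve ^ 2 / ((r : ℝ) * ((r : ℝ) - 1)),
      2 * (vu + ve / r) ^ 2 + 2 * ve ^ 2 / ((r : ℝ) ^ 2 * ((r : ℝ) - 1))]

end OneWay

end

/-!
For data with variation within units, write `A` for the mean square within units, `B` for
`∑ᵢⱼ (ȳᵢ. - ȳ..)² / a`, and `t = σ²_ε`, `l = σ²_ε + r σ²_u`. Up to constants, `-2 / a` times the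
log-likelihood is `(r - 1) (log t + A / t) + (log l + B / l) + r (m - ȳ..)² / l`, to be minimized
over `0 < t ≤ l`. The bound `log x ≥ log x₀ + 1 - x₀ / x` shows that the minimizer is unique: with
`s = ((r - 1) A + B) / r`, it is `t = min A s`, `l = max B s` (`profile_lt`). Hence every maximum
likelihood estimator equals `explicitMLE` as soon as `A > 0`
(`IsMLEstimator.eq_explicitMLE`).

Under the model, `A` is an average of i.i.d. variables with mean `σ²_ε`, and `B` is `r` times the
sample variance of the i.i.d. variables `Uᵢ + ε̄ᵢ.`. By the strong law `A → σ²_ε`, and if the `Uᵢ`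
are square integrable then `B → r σ²_u + σ²_ε`, which gives the consistency of the estimator of
`σ²_u`. The consistency of `min A s` needs only that `B` is asymptotically at least `σ²_ε`. This
holds for arbitrary `Uᵢ` (`ae_eventually_lt_sampleVar_add`): truncation to `[-M, M]` does not
increase sample variances, the strong law applies to the truncated variables, and for large `M`
their variance exceeds any `c < Var ε̄ᵢ.`; otherwise, by Fatou's lemma, the difference of two of the
variables would be square integrable with too small a second moment.

In the Gaussian case with `σ²_u > 0`, eventually `A < B`, so the estimators are `A` and
`(B - A) / r`. These are averages over the units of a random vector (`unitStat`), up to the square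
of the overall mean of the `Uᵢ + ε̄ᵢ.`, which is `O(1 / a)` in `L¹`. The multivariate central limit
theorem (`tendstoInDistribution_multivariateGaussian`) and Slutsky's theorem give the limit. The
covariance matrix comes from the independence of `Uᵢ + ε̄ᵢ.` and the sum of squares within unit
`i`, and from `Var (N²) = 2 (Var N)²` for centred Gaussian `N`.
-/

/-! ### The maximum likelihood estimate in closed form -/

namespace OneWay

lemma log_add_one_sub_div_le {x x₀ : ℝ} (hx : 0 < x) (hx₀ : 0 < x₀) :
    Real.log x₀ + 1 - x₀ / x ≤ Real.log x := by
  have h := Real.log_le_sub_one_of_pos (div_pos hx₀ hx)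
  rw [Real.log_div hx₀.ne' hx.ne'] at h
  linarith

lemma log_add_one_sub_div_lt {x x₀ : ℝ} (hx : 0 < x) (hx₀ : 0 < x₀) (h : x ≠ x₀) :
    Real.log x₀ + 1 - x₀ / x < Real.log x := by
  have h := Real.log_lt_sub_one_of_pos (div_pos hx₀ hx)
    (fun h' => h ((div_eq_one_iff_eq hx.ne').1 h').symm)
  rw [Real.log_div hx₀.ne' hx.ne'] at h
  linarith

/-- The constrained minimization behind maximum likelihood: over `0 < t ≤ l`, the function
`n (log t + A / t) + (log l + B / l)` has a unique minimizer. -/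
lemma profile_lt {n A B t l : ℝ} (hn : 0 < n) (hA : 0 < A) (hB : 0 ≤ B) (ht : 0 < t)
    (htl : t ≤ l)
    (hne : ¬ (t = min A ((n * A + B) / (n + 1)) ∧ l = max B ((n * A + B) / (n + 1)))) :
    n * (Real.log (min A ((n * A + B) / (n + 1))) + A / min A ((n * A + B) / (n + 1)))
        + (Real.log (max B ((n * A + B) / (n + 1))) + B / max B ((n * A + B) / (n + 1)))
      < n * (Real.log t + A / t) + (Real.log l + B / l) := by
  have hl : 0 < l := ht.trans_le htl
  have hs : 0 < (n * A + B) / (n + 1) := by positivity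
  obtain ⟨s, hs_def⟩ : ∃ s, s = (n * A + B) / (n + 1) := ⟨_, rfl⟩
  rw [← hs_def] at hs hne ⊢
  have hsum : n * (A - s) = s - B := by rw [hs_def]; field_simp; ring
  obtain ⟨t₀, ht₀⟩ : ∃ t₀, t₀ = min A s := ⟨_, rfl⟩
  obtain ⟨l₀, hl₀⟩ : ∃ l₀, l₀ = max B s := ⟨_, rfl⟩
  rw [← ht₀, ← hl₀] at hne ⊢
  have ht₀_pos : 0 < t₀ := by rw [ht₀]; exact lt_min hA hs
  have hl₀_pos : 0 < l₀ := by rw [hl₀]; exact lt_max_of_lt_right hs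
  -- `n (A - t₀) = l₀ - B` is the multiplier of the constraint `t ≤ l`
  have hmult : n * (A - t₀) = l₀ - B ∧ 0 ≤ l₀ - B ∧ (l₀ - B) / t₀ = (l₀ - B) / l₀ := by
    rcases le_total A s with h | h
    · have h1 : s ≤ B := by nlinarith
      rw [ht₀, hl₀, min_eq_left h, max_eq_left h1]
      simp
    · have h1 : B ≤ s := by nlinarith
      rw [ht₀, hl₀, min_eq_right h, max_eq_right h1]
      exact ⟨hsum, by linarith, rfl⟩
  obtain ⟨h1, h2, h3⟩ := hmult
  have hval : n * (A / t₀) + B / l₀ = n + 1 := by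
    have e1 : n * (A / t₀) = n + n * (A - t₀) / t₀ := by field_simp; ring
    have e2 : B / l₀ = 1 - (l₀ - B) / l₀ := by field_simp; ring
    rw [e1, e2, h1, h3]; ring
  have hcons : (l₀ - B) / l ≤ (l₀ - B) / t := by gcongr
  have hval' : n * (A / t) + B / l
      = n * (t₀ / t) + l₀ / l + ((l₀ - B) / t - (l₀ - B) / l) := by
    have e : n * (A / t) = n * (t₀ / t) + n * (A - t₀) / t := by field_simp; ring
    rw [e, h1]; field_simp; ring
  have k1 := log_add_one_sub_div_le ht ht₀_pos
  have k2 := log_add_one_sub_div_le hl hl₀_pos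
  have k3 := mul_le_mul_of_nonneg_left k1 hn.le
  rcases not_and_or.1 hne with h | h
  · have k4 := mul_lt_mul_of_pos_left (log_add_one_sub_div_lt ht ht₀_pos h) hn
    linarith
  · have k4 := log_add_one_sub_div_lt hl hl₀_pos h
    linarith

section estimate

variable {a r : ℕ} (y : Fin a → Fin r → ℝ)

/-- The mean square within units, `∑ᵢⱼ (yᵢⱼ - ȳᵢ.)² / (a (r - 1))`. -/
noncomputable def msWithin : ℝ := (∑ i, ∑ j, (y i j - unitMean y i) ^ 2) / (a * (r - 1))

/-- The sum of squares between units `∑ᵢⱼ (ȳᵢ. - ȳ..)²`, divided by the number `a` of units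
(and not by the degrees of freedom `a - 1`). -/
noncomputable def msBetween : ℝ := (∑ i, ∑ _j : Fin r, (unitMean y i - grandMean y) ^ 2) / a

/-- The closed form of the maximum likelihood estimate. Where `msBetween y < msWithin y`, the
constraint `0 ≤ σ²_u` is active, and all the variation is attributed to the errors. -/
noncomputable def explicitMLE : Params where
  mu := grandMean y
  varU := max 0 ((msBetween y - msWithin y) / r)
  varE := min (msWithin y) (((r - 1) * msWithin y + msBetween y) / r)

variable {y}

lemma explicitMLE_total (hr : 2 ≤ r) :
    (explicitMLE y).varE + r * (explicitMLE y).varU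
      = max (msBetween y) (((r - 1) * msWithin y + msBetween y) / r) := by
  have hr' : (0 : ℝ) < r := by positivity
  have hr1 : (0 : ℝ) < r - 1 := by
    have : (2 : ℝ) ≤ r := by exact_mod_cast hr
    linarith
  obtain ⟨s, hs⟩ : ∃ s, s = ((r - 1) * msWithin y + msBetween y) / (r : ℝ) := ⟨_, rfl⟩
  have hsum : (r - 1) * (msWithin y - s) = s - msBetween y := by rw [hs]; field_simp; ring
  simp only [explicitMLE]
  rw [← hs]
  rcases le_total (msWithin y) s with h | h
  · have h1 : s ≤ msBetween y := by nlinarith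
    rw [min_eq_left h, max_eq_left h1, max_eq_right (div_nonneg (by linarith) hr'.le)]
    field_simp; ring
  · have h1 : msBetween y ≤ s := by nlinarith
    rw [min_eq_right h, max_eq_right h1,
      max_eq_left (div_nonpos_of_nonpos_of_nonneg (by linarith) hr'.le)]
    ring

lemma msBetween_nonneg : 0 ≤ msBetween y := by unfold msBetween; positivity

lemma explicitMLE_mem (hr : 2 ≤ r) (hy : 0 < msWithin y) : explicitMLE y ∈ paramSpace := by
  have hr1 : (0 : ℝ) < r - 1 := by
    have : (2 : ℝ) ≤ r := by exact_mod_cast hr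
    linarith
  have := msBetween_nonneg (y := y)
  exact ⟨le_max_left _ _, lt_min hy (by positivity)⟩

lemma likelihood_eq (ha : 0 < a) (hr : 2 ≤ r) {θ : Params} (hθ : θ ∈ paramSpace) :
    likelihood y θ = (2 * Real.pi) ^ (-((a : ℝ) * r) / 2) * Real.exp (-(a / 2) *
      ((r - 1) * (Real.log θ.varE + msWithin y / θ.varE)
        + (Real.log (θ.varE + r * θ.varU) + msBetween y / (θ.varE + r * θ.varU))
        + r * (θ.mu - grandMean y) ^ 2 / (θ.varE + r * θ.varU))) := by
  obtain ⟨hu, he⟩ := hθ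
  have hl : 0 < θ.varE + r * θ.varU := by positivity
  have ha' : (0 : ℝ) < a := by exact_mod_cast ha
  have hr1 : (0 : ℝ) < r - 1 := by
    have : (2 : ℝ) ≤ r := by exact_mod_cast hr
    linarith
  unfold likelihood msWithin msBetween
  rw [Real.rpow_def_of_pos he, Real.rpow_def_of_pos hl, mul_assoc, mul_assoc, ← Real.exp_add,
    ← Real.exp_add]
  congr 2
  field_simp
  ring

/-- The likelihood is strictly larger at `explicitMLE y` than at all other parameters. -/
lemma likelihood_lt_explicitMLE (ha : 0 < a) (hr : 2 ≤ r) (hy : 0 < msWithin y) {θ : Params}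
    (hθ : θ ∈ paramSpace) (hne : θ ≠ explicitMLE y) :
    likelihood y θ < likelihood y (explicitMLE y) := by
  have hr' : (0 : ℝ) < r := by positivity
  have hr1 : (0 : ℝ) < r - 1 := by
    have : (2 : ℝ) ≤ r := by exact_mod_cast hr
    linarith
  have ha' : (0 : ℝ) < a := by exact_mod_cast ha
  rw [likelihood_eq ha hr hθ, likelihood_eq ha hr (explicitMLE_mem hr hy)]
  refine mul_lt_mul_of_pos_left (Real.exp_lt_exp.2 ?_) (by positivity)
  refine mul_lt_mul_of_neg_left ?_ (by linarith)
  obtain ⟨hu, he⟩ := hθ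
  have hl : 0 < θ.varE + r * θ.varU := by positivity
  have htl : θ.varE ≤ θ.varE + r * θ.varU := by linarith [mul_nonneg hr'.le hu]
  have hmu : (explicitMLE y).mu = grandMean y := rfl
  have key := @profile_lt (r - 1) (msWithin y) (msBetween y) θ.varE (θ.varE + r * θ.varU) hr1 hy
    msBetween_nonneg he htl
  rw [sub_add_cancel, ← explicitMLE_total hr] at key
  change ¬ (θ.varE = (explicitMLE y).varE ∧ _) → (r - 1) * (Real.log (explicitMLE y).varE +
    _ / (explicitMLE y).varE) + _ < _ at key
  rw [hmu, sub_self]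
  by_cases h : θ.varE = (explicitMLE y).varE ∧
      θ.varE + r * θ.varU = (explicitMLE y).varE + r * (explicitMLE y).varU
  · have hm : θ.mu ≠ grandMean y := by
      intro hm
      apply hne
      have h2 : θ.varU = (explicitMLE y).varU := by
        have := h.2
        rw [h.1] at this
        exact mul_left_cancel₀ hr'.ne' (add_left_cancel this)
      cases θ
      simp only at hm h h2
      rw [hm, h.1, h2]
      rfl
    have : 0 < (θ.mu - grandMean y) ^ 2 := by
      have := sub_ne_zero.2 hm
      positivity
    rw [← h.2, ← h.1]
    simp only [ne_eq, OfNat.ofNat_ne_zero, not_false_eq_true, zero_pow, mul_zero, zero_div,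
      add_zero, lt_add_iff_pos_right]
    positivity
  · have h3 : 0 ≤ r * (θ.mu - grandMean y) ^ 2 / (θ.varE + r * θ.varU) := by positivity
    have := key h
    simp only [ne_eq, OfNat.ofNat_ne_zero, not_false_eq_true, zero_pow, mul_zero, zero_div,
      add_zero]
    linarith

/-- If there is variation within units, a maximum likelihood estimator takes its value at the
unique maximizer of the likelihood. -/
lemma IsMLEstimator.eq_explicitMLE {T : (Fin a → Fin r → ℝ) → Params} (hT : IsMLEstimator T)
    (ha : 0 < a) (hr : 2 ≤ r) (hy : 0 < msWithin y) : T y = explicitMLE y := by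
  have hmem := explicitMLE_mem hr hy
  have hex : IsMLEstimate y (explicitMLE y) := by
    refine ⟨hmem, fun θ hθ => ?_⟩
    by_cases h : θ = explicitMLE y
    · exact le_of_eq (congrArg (likelihood y) h)
    · exact (likelihood_lt_explicitMLE ha hr hy hθ h).le
  obtain ⟨h1, h2⟩ := hT y ⟨_, hex⟩
  by_contra h
  exact (likelihood_lt_explicitMLE ha hr hy h1 h).not_ge (h2 hmem)

end estimate

end OneWay

/-! ### Sample variances of independent sequences -/

namespace OneWay

/-- The sample variance `∑ (xᵢ - x̄)² / a` of the first `a` terms of `x`, with divisor `a`. -/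
noncomputable def sampleVar (x : ℕ → ℝ) (a : ℕ) : ℝ :=
  (∑ i ∈ Finset.range a, (x i - (∑ k ∈ Finset.range a, x k) / a) ^ 2) / a

lemma sum_sub_sq {ι : Type*} (s : Finset ι) (x : ι → ℝ) (c : ℝ) :
    ∑ i ∈ s, (x i - c) ^ 2 = ∑ i ∈ s, x i ^ 2 - 2 * c * ∑ i ∈ s, x i + s.card * c ^ 2 := by
  simp only [sub_sq, Finset.sum_add_distrib, Finset.sum_sub_distrib, Finset.sum_const,
    nsmul_eq_mul, Finset.mul_sum]
  congr 2
  exact Finset.sum_congr rfl fun i _ => by ring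

lemma sampleVar_eq (x : ℕ → ℝ) (a : ℕ) :
    sampleVar x a = (∑ i ∈ Finset.range a, x i ^ 2) / a
      - ((∑ i ∈ Finset.range a, x i) / a) ^ 2 := by
  rcases a.eq_zero_or_pos with rfl | ha
  · simp [sampleVar]
  have ha' : (a : ℝ) ≠ 0 := by positivity
  rw [sampleVar, sum_sub_sq, Finset.card_range]
  field_simp
  ring

lemma sampleVar_const_add (c : ℝ) (x : ℕ → ℝ) (a : ℕ) :
    sampleVar (fun i => c + x i) a = sampleVar x a := by
  rcases a.eq_zero_or_pos with rfl | ha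
  · simp [sampleVar]
  have ha' : (a : ℝ) ≠ 0 := by positivity
  unfold sampleVar
  congr 1
  refine Finset.sum_congr rfl fun i _ => ?_
  rw [Finset.sum_add_distrib, Finset.sum_const, Finset.card_range, nsmul_eq_mul]
  congr 1
  field_simp
  ring

/-- The sample variance is the least mean square deviation from a constant, so a contraction of
the line does not increase it. -/
lemma sampleVar_comp_le {g : ℝ → ℝ} (hg : LipschitzWith 1 g) (x : ℕ → ℝ) (a : ℕ) :
    sampleVar (fun i => g (x i)) a ≤ sampleVar x a := by
  rcases a.eq_zero_or_pos with rfl | ha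
  · simp [sampleVar]
  have ha' : (0 : ℝ) < a := by positivity
  unfold sampleVar
  refine div_le_div_of_nonneg_right ?_ ha'.le
  obtain ⟨m, hm⟩ : ∃ m, m = (∑ k ∈ Finset.range a, x k) / (a : ℝ) := ⟨_, rfl⟩
  rw [← hm]
  trans ∑ i ∈ Finset.range a, (g (x i) - g m) ^ 2
  · rw [sum_sub_sq, sum_sub_sq, Finset.card_range]
    obtain ⟨S, hS⟩ : ∃ S, S = ∑ k ∈ Finset.range a, g (x k) := ⟨_, rfl⟩
    rw [← hS]
    have : 0 ≤ (a : ℝ) * (S / a - g m) ^ 2 := by positivity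
    have e : (a : ℝ) * (S / a - g m) ^ 2 = (a * (g m) ^ 2 - 2 * g m * S)
        - (a * (S / a) ^ 2 - 2 * (S / a) * S) := by field_simp; ring
    linarith
  · refine Finset.sum_le_sum fun i _ => sq_le_sq.2 ?_
    simpa [Real.dist_eq] using hg.dist_le_mul (x i) m

section probability

variable {Ω : Type*} [MeasurableSpace Ω] {P : Measure Ω} [IsProbabilityMeasure P]

lemma ae_tendsto_sampleVar {X : ℕ → Ω → ℝ} (hX : MemLp (X 0) 2 P) (hindep : iIndepFun X P)
    (hident : ∀ i, IdentDistrib (X i) (X 0) P P) :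
    ∀ᵐ ω ∂P, Tendsto (sampleVar fun i => X i ω) atTop (𝓝 Var[X 0; P]) := by
  have h1 := strong_law_ae_real X (hX.integrable one_le_two)
    (fun i j hij => hindep.indepFun hij) hident
  have h2 := strong_law_ae_real (fun i ω => X i ω ^ 2) hX.integrable_sq
    (fun i j hij => (hindep.indepFun hij).comp (φ := fun x => x ^ 2) (ψ := fun x => x ^ 2)
      (by fun_prop) (by fun_prop))
    (fun i => (hident i).comp (u := fun x => x ^ 2) (by fun_prop))
  filter_upwards [h1, h2] with ω h1 h2
  rw [variance_eq_sub hX]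
  refine (h2.sub (h1.pow 2)).congr fun a => ?_
  rw [sampleVar_eq]

/-- The truncation of the line to `[-M, M]`, for `0 ≤ M`. -/
def clamp (M x : ℝ) : ℝ := max (-M) (min M x)

lemma lipschitzWith_clamp (M : ℝ) : LipschitzWith 1 (clamp M) :=
  (LipschitzWith.id.const_min M).const_max (-M)

lemma measurable_clamp (M : ℝ) : Measurable (clamp M) :=
  (lipschitzWith_clamp M).continuous.measurable

lemma abs_clamp_le {M : ℝ} (hM : 0 ≤ M) (x : ℝ) : |clamp M x| ≤ M :=
  abs_le.2 ⟨le_max_left _ _, max_le (by linarith) (min_le_left _ _)⟩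

lemma clamp_eq_self {M x : ℝ} (h : |x| ≤ M) : clamp M x = x := by
  obtain ⟨h1, h2⟩ := abs_le.1 h
  rw [clamp, min_eq_right h2, max_eq_right h1]

lemma memLp_clamp {X : Ω → ℝ} (hX : Measurable X) (M : ℕ) :
    MemLp (fun ω => clamp M (X ω)) 2 P :=
  .of_bound ((measurable_clamp M).comp hX).aestronglyMeasurable M
    (ae_of_all _ fun ω => abs_clamp_le M.cast_nonneg (X ω))

lemma integral_sub_sq_of_identDistrib {X Y : Ω → ℝ} (hX : MemLp X 2 P) (hXY : X ⟂ᵢ[P] Y)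
    (hid : IdentDistrib X Y P P) : ∫ ω, (X ω - Y ω) ^ 2 ∂P = 2 * Var[X; P] := by
  have hY : MemLp Y 2 P := hid.memLp_iff.1 hX
  have hm : ∫ ω, (X ω - Y ω) ∂P = 0 := by
    rw [integral_sub (hX.integrable one_le_two) (hY.integrable one_le_two), hid.integral_eq,
      sub_self]
  have h1 : Var[fun ω => X ω - Y ω; P] = ∫ ω, (X ω - Y ω) ^ 2 ∂P :=
    variance_of_integral_eq_zero (hX.aemeasurable.sub hY.aemeasurable) hm
  rw [← h1, variance_fun_sub hX hY, hXY.covariance_eq_zero hX hY, ← hid.variance_eq]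
  ring

/-- Let `X` and `Y` be independent with the same law. If the variances of their truncations stay
below `c`, then `X - Y` is square integrable, and `E (X - Y)² ≤ 2 c`: by Fatou's lemma. -/
lemma memLp_sub_of_variance_clamp_le {X Y : Ω → ℝ} (hX : Measurable X) (hY : Measurable Y)
    (hXY : X ⟂ᵢ[P] Y) (hid : IdentDistrib X Y P P) {c : ℝ}
    (hc : ∀ M : ℕ, Var[fun ω => clamp M (X ω); P] ≤ c) :
    MemLp (fun ω => X ω - Y ω) 2 P ∧ ∫ ω, (X ω - Y ω) ^ 2 ∂P ≤ 2 * c := by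
  have hc0 : 0 ≤ c := (variance_nonneg _ _).trans (hc 0)
  have hb : ∀ M : ℕ, ∫⁻ ω, ENNReal.ofReal ((clamp M (X ω) - clamp M (Y ω)) ^ 2) ∂P
      ≤ ENNReal.ofReal (2 * c) := by
    intro M
    have hXM := memLp_clamp (P := P) hX M
    have hYM := memLp_clamp (P := P) hY M
    have hint : Integrable (fun ω => (clamp M (X ω) - clamp M (Y ω)) ^ 2) P :=
      (hXM.sub hYM).integrable_sq
    rw [← ofReal_integral_eq_lintegral_ofReal hint
      (ae_of_all _ fun ω => sq_nonneg _)]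
    refine ENNReal.ofReal_le_ofReal ?_
    have := integral_sub_sq_of_identDistrib hXM
      (hXY.comp (measurable_clamp M) (measurable_clamp M)) (hid.comp (measurable_clamp M))
    exact this.le.trans (by linarith [hc M])
  have hlim : ∫⁻ ω, ENNReal.ofReal ((X ω - Y ω) ^ 2) ∂P ≤ ENNReal.ofReal (2 * c) := by
    calc ∫⁻ ω, ENNReal.ofReal ((X ω - Y ω) ^ 2) ∂P
        = ∫⁻ ω, liminf (fun M : ℕ => ENNReal.ofReal ((clamp M (X ω) - clamp M (Y ω)) ^ 2))
            atTop ∂P := by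
          refine lintegral_congr fun ω => (Tendsto.liminf_eq ?_).symm
          refine tendsto_const_nhds.congr' ?_
          filter_upwards [eventually_ge_atTop ⌈|X ω|⌉₊, eventually_ge_atTop ⌈|Y ω|⌉₊]
            with M h1 h2
          rw [clamp_eq_self (Nat.ceil_le.1 h1), clamp_eq_self (Nat.ceil_le.1 h2)]
      _ ≤ liminf (fun M : ℕ => ∫⁻ ω, ENNReal.ofReal ((clamp M (X ω) - clamp M (Y ω)) ^ 2) ∂P)
            atTop := by
          refine lintegral_liminf_le fun M => ?_
          have h1 := measurable_clamp M
          fun_prop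
      _ ≤ ENNReal.ofReal (2 * c) := by
          refine (liminf_le_liminf (Eventually.of_forall hb)).trans ?_
          simp
  have hint : Integrable (fun ω => (X ω - Y ω) ^ 2) P := by
    refine ⟨by fun_prop, ?_⟩
    rw [hasFiniteIntegral_iff_ofReal (ae_of_all _ fun ω => sq_nonneg _)]
    exact hlim.trans_lt ENNReal.ofReal_lt_top
  refine ⟨(memLp_two_iff_integrable_sq (by fun_prop)).2 hint, ?_⟩
  rw [← ofReal_integral_eq_lintegral_ofReal hint (ae_of_all _ fun ω => sq_nonneg _)] at hlim
  exact (ENNReal.ofReal_le_ofReal_iff (by positivity)).1 hlim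

/-- The sample variances of an independent sequence with the common law of `A i + B i` are
asymptotically at least the variance of `B 0`, if `A 0 - A 1` and `B 0 - B 1` are independent.
Nothing is assumed on the moments of `A`; truncation reduces this to bounded variables. -/
lemma ae_eventually_lt_sampleVar_add {A B : ℕ → Ω → ℝ} (hA : ∀ i, Measurable (A i))
    (hBm : ∀ i, Measurable (B i)) (hB : MemLp (B 0) 2 P)
    (hindep : iIndepFun (fun i ω => A i ω + B i ω) P)
    (hident : ∀ i, IdentDistrib (fun ω => A i ω + B i ω) (fun ω => A 0 ω + B 0 ω) P P)
    (hidB : IdentDistrib (B 0) (B 1) P P) (hindB : B 0 ⟂ᵢ[P] B 1)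
    (hAB : (fun ω => A 0 ω - A 1 ω) ⟂ᵢ[P] (fun ω => B 0 ω - B 1 ω)) :
    ∀ᵐ ω ∂P, ∀ c < Var[B 0; P], ∀ᶠ a in atTop, c < sampleVar (fun i => A i ω + B i ω) a := by
  have key : ∀ c < Var[B 0; P], ∃ M : ℕ, c < Var[fun ω => clamp M (A 0 ω + B 0 ω); P] := by
    intro c hc
    by_contra! hcon
    obtain ⟨hD, hle⟩ := memLp_sub_of_variance_clamp_le
      (X := fun ω => A 0 ω + B 0 ω) (Y := fun ω => A 1 ω + B 1 ω)
      ((hA 0).add (hBm 0)) ((hA 1).add (hBm 1)) (hindep.indepFun zero_ne_one) (hident 1).symm hcon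
    have hB1 : MemLp (B 1) 2 P := hidB.memLp_iff.1 hB
    have hBB : MemLp (fun ω => B 0 ω - B 1 ω) 2 P := hB.sub hB1
    have hAA : MemLp (fun ω => A 0 ω - A 1 ω) 2 P := by
      convert! hD.sub hBB using 2
      simp; ring
    have h1 : Var[fun ω => A 0 ω + B 0 ω - (A 1 ω + B 1 ω); P]
        = Var[fun ω => A 0 ω - A 1 ω; P] + Var[fun ω => B 0 ω - B 1 ω; P] := by
      rw [← hAB.variance_fun_add hAA hBB]
      congr 1
      ext ω
      ring
    have h2 : Var[fun ω => B 0 ω - B 1 ω; P] = 2 * Var[B 0; P] := by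
      rw [variance_fun_sub hB hB1, hindB.covariance_eq_zero hB hB1, ← hidB.variance_eq]
      ring
    have h3 := variance_nonneg (fun ω => A 0 ω - A 1 ω) P
    have h4 := variance_le_expectation_sq (μ := P) hD.1
    have h5 : P[(fun ω => A 0 ω + B 0 ω - (A 1 ω + B 1 ω)) ^ 2] ≤ 2 * c := hle
    linarith
  have hM : ∀ᵐ ω ∂P, ∀ M : ℕ, Tendsto (sampleVar fun i => clamp M (A i ω + B i ω)) atTop
      (𝓝 Var[fun ω => clamp M (A 0 ω + B 0 ω); P]) := by
    refine ae_all_iff.2 fun M => ?_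
    exact ae_tendsto_sampleVar (X := fun i ω => clamp M (A i ω + B i ω))
      (memLp_clamp ((hA 0).add (hBm 0)) M)
      (hindep.comp (fun _ => clamp M) fun _ => measurable_clamp M)
      fun i => (hident i).comp (measurable_clamp M)
  filter_upwards [hM] with ω hω c hc
  obtain ⟨M, hM⟩ := key c hc
  filter_upwards [(hω M).eventually_const_lt hM] with a ha
  exact ha.trans_le (sampleVar_comp_le (lipschitzWith_clamp M) _ a)

end probability

end OneWay

/-! ### The units as independent identically distributed blocks -/

namespace OneWay

/-- Grouping an independent family along a partition of its index type yields independent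
tuples: the converse of `ProbabilityTheory.iIndepFun_uncurry`. -/
lemma iIndepFun_curry {Ω ι : Type*} [MeasurableSpace Ω] {P : Measure Ω} {κ : ι → Type*}
    {𝓧 : (i : ι) → κ i → Type*} [∀ i j, MeasurableSpace (𝓧 i j)]
    {X : (i : ι) → (j : κ i) → Ω → 𝓧 i j} (mX : ∀ i j, Measurable (X i j))
    (h : iIndepFun (fun (p : (i : ι) × κ i) ω => X p.1 p.2 ω) P) :
    iIndepFun (fun i ω => (X i · ω)) P := by
  have := h.isProbabilityMeasure
  have hpr : ∀ i j, IsProbabilityMeasure (P.map (X i j)) :=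
    fun i j => Measure.isProbabilityMeasure_map (mX i j).aemeasurable
  have hcurry : (MeasurableEquiv.piCurry 𝓧) ∘ (fun ω p => X p.1 p.2 ω) = fun ω i j => X i j ω := by
    ext; simp [Sigma.curry]
  have hrow : ∀ i, iIndepFun (X i) P := fun i =>
    h.precomp (g := fun j => (⟨i, j⟩ : (i : ι) × κ i)) (sigma_mk_injective (i := i))
  rw [iIndepFun_iff_map_fun_eq_infinitePi_map (fun i => measurable_pi_lambda _ (mX i)), ← hcurry,
    ← Measure.map_map (by fun_prop) (measurable_pi_lambda _ fun p => mX p.1 p.2),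
    (iIndepFun_iff_map_fun_eq_infinitePi_map (fun p => mX p.1 p.2)).1 h,
    Measure.infinitePi_map_piCurry (fun i j => P.map (X i j))]
  congr 1
  ext1 i
  exact ((iIndepFun_iff_map_fun_eq_infinitePi_map (mX i)).1 (hrow i)).symm

section statistics

variable {Ω : Type*} {r : ℕ}

/-- The mean `ε̄ᵢ.` of the errors in unit `i`. -/
noncomputable def errorMean (ε : ℕ → Fin r → Ω → ℝ) (i : ℕ) (ω : Ω) : ℝ := (∑ j, ε i j ω) / r

/-- The sum of squared deviations `∑ⱼ (εᵢⱼ - ε̄ᵢ.)²` within unit `i`. -/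
noncomputable def errorSS (ε : ℕ → Fin r → Ω → ℝ) (i : ℕ) (ω : Ω) : ℝ :=
  ∑ j, (ε i j ω - errorMean ε i ω) ^ 2

lemma unitMean_sample (hr : r ≠ 0) (μ : ℝ) (U : ℕ → Ω → ℝ) (ε : ℕ → Fin r → Ω → ℝ) (a : ℕ)
    (ω : Ω) (i : Fin a) :
    unitMean (sample μ U ε a ω) i = μ + (U i ω + errorMean ε i ω) := by
  have : (r : ℝ) ≠ 0 := by exact_mod_cast hr
  simp only [unitMean, sample, errorMean, Finset.sum_add_distrib, Finset.sum_const,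
    Finset.card_univ, Fintype.card_fin, nsmul_eq_mul]
  field_simp
  ring

lemma msWithin_sample (hr : r ≠ 0) (μ : ℝ) (U : ℕ → Ω → ℝ) (ε : ℕ → Fin r → Ω → ℝ) (a : ℕ)
    (ω : Ω) :
    msWithin (sample μ U ε a ω) = (∑ i ∈ Finset.range a, errorSS ε i ω) / a / (r - 1) := by
  rw [← Fin.sum_univ_eq_sum_range (fun i => errorSS ε i ω), msWithin, div_div]
  congr 1
  refine Finset.sum_congr rfl fun i _ => Finset.sum_congr rfl fun j _ => ?_
  rw [unitMean_sample hr, sample]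
  ring

lemma msBetween_sample (hr : r ≠ 0) (μ : ℝ) (U : ℕ → Ω → ℝ) (ε : ℕ → Fin r → Ω → ℝ) (a : ℕ)
    (ω : Ω) :
    msBetween (sample μ U ε a ω) = r * sampleVar (fun i => U i ω + errorMean ε i ω) a := by
  have hr' : (r : ℝ) ≠ 0 := by exact_mod_cast hr
  rw [← sampleVar_const_add μ, sampleVar,
    ← Fin.sum_univ_eq_sum_range (fun i => μ + (U i ω + errorMean ε i ω)),
    ← Fin.sum_univ_eq_sum_range (fun i => (μ + (U i ω + errorMean ε i ω) - _) ^ 2), msBetween,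
    ← mul_div_assoc, Finset.mul_sum]
  congr 1
  refine Finset.sum_congr rfl fun i _ => ?_
  have hg : grandMean (sample μ U ε a ω)
      = (∑ i : Fin a, (μ + (U i ω + errorMean ε i ω))) / a := by
    rw [grandMean, mul_comm, ← div_div, Finset.sum_div]
    congr 1
    exact Finset.sum_congr rfl fun i _ => unitMean_sample hr μ U ε a ω i
  rw [hg, unitMean_sample hr]
  simp

/-- The expansion `∑ⱼ (εᵢⱼ - ε̄ᵢ.)² = ∑ⱼ εᵢⱼ² - r ε̄ᵢ.²`. -/
lemma errorSS_eq (hr : r ≠ 0) (ε : ℕ → Fin r → Ω → ℝ) (i : ℕ) (ω : Ω) :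
    errorSS ε i ω = ∑ j, ε i j ω ^ 2 - r * errorMean ε i ω ^ 2 := by
  have hr' : (r : ℝ) ≠ 0 := by exact_mod_cast hr
  rw [errorSS, sum_sub_sq, Finset.card_univ, Fintype.card_fin, errorMean]
  field_simp
  ring

end statistics

namespace IsRandomEffects

variable {Ω : Type*} [MeasurableSpace Ω] {r : ℕ} {P : Measure Ω}
  {U : ℕ → Ω → ℝ} {ε : ℕ → Fin r → Ω → ℝ}

lemma measurable_elim (h : IsRandomEffects P U ε) (k : ℕ ⊕ ℕ × Fin r) :
    Measurable (Sum.elim U (fun p : ℕ × Fin r => ε p.1 p.2) k) := by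
  cases k
  · exact h.measurable_U _
  · exact h.measurable_ε _ _

lemma measurable_errorMean (h : IsRandomEffects P U ε) (i : ℕ) : Measurable (errorMean ε i) := by
  have := h.measurable_ε i
  unfold errorMean
  fun_prop

lemma measurable_errorSS (h : IsRandomEffects P U ε) (i : ℕ) : Measurable (errorSS ε i) := by
  have := h.measurable_ε i
  have := h.measurable_errorMean i
  unfold errorSS
  fun_prop

/-- The variables of unit `i`: the effect `U i`, at index `none`, and the errors. -/
def block (U : ℕ → Ω → ℝ) (ε : ℕ → Fin r → Ω → ℝ) (i : ℕ) : Option (Fin r) → Ω → ℝ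
  | none => U i
  | some j => ε i j

lemma measurable_block (h : IsRandomEffects P U ε) (i : ℕ) (k : Option (Fin r)) :
    Measurable (block U ε i k) := by
  cases k
  · exact h.measurable_U _
  · exact h.measurable_ε _ _

lemma iIndepFun_sigma_block (h : IsRandomEffects P U ε) :
    iIndepFun (fun (p : (_ : ℕ) × Option (Fin r)) ω => block U ε p.1 p.2 ω) P := by
  have hinj : Function.Injective (fun p : (_ : ℕ) × Option (Fin r) =>
      (p.2.elim (Sum.inl p.1) (fun j => Sum.inr (p.1, j)) : ℕ ⊕ ℕ × Fin r)) := by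
    rintro ⟨i, _ | j⟩ ⟨i', _ | j'⟩ <;> simp +contextual
  convert! h.indep.precomp hinj using 2 with p
  obtain ⟨i, _ | j⟩ := p <;> rfl

lemma iIndepFun_block (h : IsRandomEffects P U ε) :
    iIndepFun (fun i ω k => block U ε i k ω) P :=
  iIndepFun_curry h.measurable_block h.iIndepFun_sigma_block

lemma iIndepFun_block_apply (h : IsRandomEffects P U ε) (i : ℕ) : iIndepFun (block U ε i) P :=
  h.iIndepFun_sigma_block.precomp (g := fun k => (⟨i, k⟩ : (_ : ℕ) × Option (Fin r)))
    (fun _ _ hk => by simpa using hk)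

lemma iIndepFun_error (h : IsRandomEffects P U ε) (i : ℕ) : iIndepFun (ε i) P :=
  (h.iIndepFun_block_apply i).precomp (g := some) (Option.some_injective _)

lemma identDistrib_block (h : IsRandomEffects P U ε) (i i' : ℕ) :
    IdentDistrib (fun ω k => block U ε i k ω) (fun ω k => block U ε i' k ω) P P := by
  refine IdentDistrib.pi (fun k => ?_) (h.iIndepFun_block_apply i) (h.iIndepFun_block_apply i')
  cases k
  · exact h.identDistrib_U i i'
  · exact h.identDistrib_ε i _ i' _

/-- Statistics of the units are independent, if they are given by the same function of the
variables of the unit. -/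
lemma iIndepFun_comp_block (h : IsRandomEffects P U ε) {E : Type*} [MeasurableSpace E]
    {f : (Option (Fin r) → ℝ) → E} (hf : Measurable f) :
    iIndepFun (fun i ω => f (fun k => block U ε i k ω)) P :=
  h.iIndepFun_block.comp (fun _ => f) fun _ => hf

lemma identDistrib_comp_block (h : IsRandomEffects P U ε) {E : Type*} [MeasurableSpace E]
    {f : (Option (Fin r) → ℝ) → E} (hf : Measurable f) (i i' : ℕ) :
    IdentDistrib (fun ω => f (fun k => block U ε i k ω)) (fun ω => f (fun k => block U ε i' k ω))
      P P :=
  (h.identDistrib_block i i').comp hf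

lemma iIndepFun_effect (h : IsRandomEffects P U ε) :
    iIndepFun (fun i ω => U i ω + errorMean ε i ω) P :=
  h.iIndepFun_comp_block (f := fun z => z none + (∑ j, z (some j)) / r) (by fun_prop)

lemma identDistrib_effect (h : IsRandomEffects P U ε) (i i' : ℕ) :
    IdentDistrib (fun ω => U i ω + errorMean ε i ω) (fun ω => U i' ω + errorMean ε i' ω) P P :=
  h.identDistrib_comp_block (f := fun z => z none + (∑ j, z (some j)) / r) (by fun_prop) i i'

lemma iIndepFun_errorMean (h : IsRandomEffects P U ε) : iIndepFun (errorMean ε) P :=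
  h.iIndepFun_comp_block (f := fun z => (∑ j, z (some j)) / r) (by fun_prop)

lemma identDistrib_errorMean (h : IsRandomEffects P U ε) (i i' : ℕ) :
    IdentDistrib (errorMean ε i) (errorMean ε i') P P :=
  h.identDistrib_comp_block (f := fun z => (∑ j, z (some j)) / r) (by fun_prop) i i'

lemma iIndepFun_errorSS (h : IsRandomEffects P U ε) : iIndepFun (errorSS ε) P :=
  h.iIndepFun_comp_block (f := fun z => ∑ j, (z (some j) - (∑ j, z (some j)) / r) ^ 2)
    (by fun_prop)

lemma identDistrib_errorSS (h : IsRandomEffects P U ε) (i i' : ℕ) :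
    IdentDistrib (errorSS ε i) (errorSS ε i') P P :=
  h.identDistrib_comp_block (f := fun z => ∑ j, (z (some j) - (∑ j, z (some j)) / r) ^ 2)
    (by fun_prop) i i'

/-- Functions of finitely many effects are independent of functions of finitely many errors. -/
lemma indepFun_comp (h : IsRandomEffects P U ε) (S : Finset ℕ) {E F : Type*}
    [MeasurableSpace E] [MeasurableSpace F] {f : (S → ℝ) → E} {g : (S → Fin r → ℝ) → F}
    (hf : Measurable f) (hg : Measurable g) :
    (fun ω => f fun i => U i ω) ⟂ᵢ[P] (fun ω => g fun i j => ε i j ω) := by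
  classical
  have hdisj : Disjoint (S.map ⟨Sum.inl, Sum.inl_injective⟩ : Finset (ℕ ⊕ ℕ × Fin r))
      ((S ×ˢ (Finset.univ : Finset (Fin r))).map ⟨Sum.inr, Sum.inr_injective⟩) := by
    rw [Finset.disjoint_left]
    simp
  have := h.indep.indepFun_finset _ _ hdisj h.measurable_elim
  refine this.comp (φ := fun x => f fun i => x ⟨Sum.inl i, by simp⟩)
    (ψ := fun x => g fun i j => x ⟨Sum.inr (i, j), by simp⟩) ?_ ?_
  · exact hf.comp (by fun_prop)
  · exact hg.comp (by fun_prop)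

lemma indepFun_effect_errorMean (h : IsRandomEffects P U ε) (i : ℕ) :
    U i ⟂ᵢ[P] errorMean ε i :=
  h.indepFun_comp {i} (f := fun x => x ⟨i, by simp⟩) (g := fun x => (∑ j, x ⟨i, by simp⟩ j) / r)
    (by fun_prop) (by fun_prop)

lemma indepFun_effect_sub (h : IsRandomEffects P U ε) :
    (fun ω => U 0 ω - U 1 ω) ⟂ᵢ[P] (fun ω => errorMean ε 0 ω - errorMean ε 1 ω) :=
  h.indepFun_comp {0, 1} (f := fun x => x ⟨0, by simp⟩ - x ⟨1, by simp⟩)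
    (g := fun x => (∑ j, x ⟨0, by simp⟩ j) / r - (∑ j, x ⟨1, by simp⟩ j) / r)
    (by fun_prop) (by fun_prop)

section moments

variable {ve : ℝ}

lemma memLp_errorMean (hε : ∀ i j, MemLp (ε i j) 2 P) (i : ℕ) : MemLp (errorMean ε i) 2 P := by
  have : MemLp (fun ω => ∑ j, ε i j ω) 2 P := memLp_finsetSum _ fun j _ => hε i j
  simpa only [errorMean, div_eq_mul_inv] using! this.mul_const (r : ℝ)⁻¹

lemma memLp_effect (hU : ∀ i, MemLp (U i) 2 P) (hε : ∀ i j, MemLp (ε i j) 2 P) (i : ℕ) :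
    MemLp (fun ω => U i ω + errorMean ε i ω) 2 P :=
  (hU i).add (memLp_errorMean hε i)

lemma variance_errorMean [IsProbabilityMeasure P] (h : IsRandomEffects P U ε)
    (hε : ∀ i j, MemLp (ε i j) 2 P ∧ Var[ε i j; P] = ve) (i : ℕ) :
    Var[errorMean ε i; P] = ve / r := by
  have h1 : Var[fun ω => ∑ j, ε i j ω; P] = ∑ j, Var[ε i j; P] := by
    rw [← IndepFun.variance_sum (fun j _ => (hε i j).1)
      (fun j _ k _ hjk => (h.iIndepFun_error i).indepFun hjk)]
    congr 1
    ext ω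
    simp
  have h2 : errorMean ε i = fun ω => (∑ j, ε i j ω) * (r : ℝ)⁻¹ := by
    ext ω
    rw [errorMean, div_eq_mul_inv]
  rw [h2, variance_mul_const, h1]
  simp only [(hε i _).2, Finset.sum_const, Finset.card_univ, Fintype.card_fin, nsmul_eq_mul]
  rcases eq_or_ne (r : ℝ) 0 with h0 | h0
  · simp [h0]
  · field_simp

lemma integrable_errorSS [IsProbabilityMeasure P] (hε : ∀ i j, MemLp (ε i j) 2 P) (i : ℕ) :
    Integrable (errorSS ε i) P :=
  integrable_finsetSum _ fun j _ => ((hε i j).sub (memLp_errorMean hε i)).integrable_sq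

/-- The expectation of the sum of squares within a unit has the factor `r - 1`. -/
lemma integral_errorSS [IsProbabilityMeasure P] (h : IsRandomEffects P U ε) (hr : r ≠ 0)
    (hε : ∀ i j, MemLp (ε i j) 2 P ∧ Var[ε i j; P] = ve) (i : ℕ) :
    P[errorSS ε i] = (r - 1) * ve := by
  have hr' : (r : ℝ) ≠ 0 := by exact_mod_cast hr
  have hm := memLp_errorMean (fun i j => (hε i j).1) i
  obtain ⟨m, hm'⟩ : ∃ m, m = P[ε i ⟨0, Nat.pos_of_ne_zero hr⟩] := ⟨_, rfl⟩
  have hmj : ∀ j, P[ε i j] = m := fun j => by rw [hm']; exact (h.identDistrib_ε i j i _).integral_eq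
  have h1 : P[errorMean ε i] = m := by
    unfold errorMean
    rw [integral_div, integral_finsetSum _ fun j _ => (hε i j).1.integrable one_le_two]
    simp only [hmj, Finset.sum_const, Finset.card_univ, Fintype.card_fin, nsmul_eq_mul]
    field_simp
  have h2 : P[errorMean ε i ^ 2] = ve / r + m ^ 2 := by
    have := variance_eq_sub hm
    rw [h.variance_errorMean hε, h1] at this
    linarith
  have h3 : ∀ j, P[ε i j ^ 2] = ve + m ^ 2 := fun j => by
    have := variance_eq_sub (hε i j).1
    rw [(hε i j).2, hmj] at this
    linarith
  have h4 : ∀ j, Integrable (fun ω => ε i j ω ^ 2) P := fun j => (hε i j).1.integrable_sq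
  calc P[errorSS ε i] = ∫ ω, (∑ j, ε i j ω ^ 2 - r * errorMean ε i ω ^ 2) ∂P :=
        integral_congr_ae (ae_of_all _ fun ω => errorSS_eq hr ε i ω)
    _ = ∑ j, P[ε i j ^ 2] - r * P[errorMean ε i ^ 2] := by
        rw [integral_sub (integrable_finsetSum _ fun j _ => h4 j) (hm.integrable_sq.const_mul _),
          integral_finsetSum _ fun j _ => h4 j, integral_const_mul]
        rfl
    _ = (r - 1) * ve := by
        simp only [h2, h3, Finset.sum_const, Finset.card_univ, Fintype.card_fin, nsmul_eq_mul]
        field_simp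
        ring

end moments

end IsRandomEffects

end OneWay

/-! ### Strong consistency -/

namespace OneWay

namespace IsRandomEffects

variable {Ω : Type*} [MeasurableSpace Ω] {r : ℕ} {P : Measure Ω} [IsProbabilityMeasure P]
  {U : ℕ → Ω → ℝ} {ε : ℕ → Fin r → Ω → ℝ} {vu ve : ℝ}

lemma ae_tendsto_msWithin (h : IsRandomEffects P U ε) (hr : 2 ≤ r) (μ : ℝ)
    (hε : ∀ i j, MemLp (ε i j) 2 P ∧ Var[ε i j; P] = ve) :
    ∀ᵐ ω ∂P, Tendsto (fun a => msWithin (sample μ U ε a ω)) atTop (𝓝 ve) := by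
  have hr0 : r ≠ 0 := by omega
  have hr1 : (r : ℝ) - 1 ≠ 0 := by
    have : (2 : ℝ) ≤ r := by exact_mod_cast hr
    linarith
  filter_upwards [strong_law_ae_real (errorSS ε) (integrable_errorSS (fun i j => (hε i j).1) 0)
    (fun i j hij => h.iIndepFun_errorSS.indepFun hij) (fun i => h.identDistrib_errorSS i 0)]
    with ω hω
  rw [h.integral_errorSS hr0 hε] at hω
  have := hω.div_const ((r : ℝ) - 1)
  rw [mul_div_cancel_left₀ _ hr1] at this
  exact this.congr fun a => (msWithin_sample hr0 μ U ε a ω).symm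

/-- The mean square between units is asymptotically at least the error variance, whatever the
law of the effects. -/
lemma ae_eventually_lt_msBetween (h : IsRandomEffects P U ε) (hr : 2 ≤ r) (μ : ℝ)
    (hε : ∀ i j, MemLp (ε i j) 2 P ∧ Var[ε i j; P] = ve) :
    ∀ᵐ ω ∂P, ∀ c < ve, ∀ᶠ a in atTop, c < msBetween (sample μ U ε a ω) := by
  have hr0 : r ≠ 0 := by omega
  have hr' : (0 : ℝ) < r := by positivity
  filter_upwards [ae_eventually_lt_sampleVar_add h.measurable_U h.measurable_errorMean
    (memLp_errorMean (fun i j => (hε i j).1) 0) h.iIndepFun_effect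
    (fun i => h.identDistrib_effect i 0) (h.identDistrib_errorMean 0 1)
    (h.iIndepFun_errorMean.indepFun zero_ne_one) h.indepFun_effect_sub] with ω hω c hc
  rw [h.variance_errorMean hε] at hω
  filter_upwards [hω (c / r) (div_lt_div_of_pos_right hc hr')] with a ha
  rw [msBetween_sample hr0]
  rwa [div_lt_iff₀' hr'] at ha

lemma variance_effect (h : IsRandomEffects P U ε)
    (hU : ∀ i, MemLp (U i) 2 P ∧ Var[U i; P] = vu)
    (hε : ∀ i j, MemLp (ε i j) 2 P ∧ Var[ε i j; P] = ve) (i : ℕ) :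
    Var[fun ω => U i ω + errorMean ε i ω; P] = vu + ve / r := by
  rw [(h.indepFun_effect_errorMean i).variance_fun_add (hU i).1
    (memLp_errorMean (fun i j => (hε i j).1) i), (hU i).2, h.variance_errorMean hε]

lemma ae_tendsto_msBetween (h : IsRandomEffects P U ε) (hr : 2 ≤ r) (μ : ℝ)
    (hU : ∀ i, MemLp (U i) 2 P ∧ Var[U i; P] = vu)
    (hε : ∀ i j, MemLp (ε i j) 2 P ∧ Var[ε i j; P] = ve) :
    ∀ᵐ ω ∂P, Tendsto (fun a => msBetween (sample μ U ε a ω)) atTop (𝓝 (r * vu + ve)) := by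
  have hr0 : r ≠ 0 := by omega
  have hr' : (r : ℝ) ≠ 0 := by exact_mod_cast hr0
  filter_upwards [ae_tendsto_sampleVar (X := fun i ω => U i ω + errorMean ε i ω)
    (memLp_effect (fun i => (hU i).1) (fun i j => (hε i j).1) 0)
    h.iIndepFun_effect (fun i => h.identDistrib_effect i 0)] with ω hω
  rw [h.variance_effect hU hε] at hω
  have := hω.const_mul (r : ℝ)
  rw [show (r : ℝ) * (vu + ve / r) = r * vu + ve by field_simp] at this
  exact this.congr fun a => (msBetween_sample hr0 μ U ε a ω).symm

/-- Almost surely, from some number of units on, a maximum likelihood estimator is given by the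
closed form, since the mean square within units tends to `ve > 0`. -/
lemma ae_eventually_eq_explicitMLE (h : IsRandomEffects P U ε) (hr : 2 ≤ r) (μ : ℝ)
    (hve : 0 < ve) (hε : ∀ i j, MemLp (ε i j) 2 P ∧ Var[ε i j; P] = ve)
    {T : (a : ℕ) → (Fin a → Fin r → ℝ) → Params} (hT : ∀ a, IsMLEstimator (T a)) :
    ∀ᵐ ω ∂P, ∀ᶠ a in atTop, T a (sample μ U ε a ω) = explicitMLE (sample μ U ε a ω) := by
  filter_upwards [h.ae_tendsto_msWithin hr μ hε] with ω hω
  filter_upwards [hω.eventually_const_lt hve, eventually_gt_atTop 0] with a h1 h2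
  exact (hT a).eq_explicitMLE h2 hr h1

lemma ae_tendsto_varE (h : IsRandomEffects P U ε) (hr : 2 ≤ r) (μ : ℝ)
    (hve : 0 < ve) (hε : ∀ i j, MemLp (ε i j) 2 P ∧ Var[ε i j; P] = ve)
    {T : (a : ℕ) → (Fin a → Fin r → ℝ) → Params} (hT : ∀ a, IsMLEstimator (T a)) :
    ∀ᵐ ω ∂P, Tendsto (fun a => (T a (sample μ U ε a ω)).varE) atTop (𝓝 ve) := by
  have hr' : (0 : ℝ) < r := by positivity
  have hr1 : (0 : ℝ) < r - 1 := by
    have : (2 : ℝ) ≤ r := by exact_mod_cast hr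
    linarith
  filter_upwards [h.ae_eventually_eq_explicitMLE hr μ hve hε hT, h.ae_tendsto_msWithin hr μ hε,
    h.ae_eventually_lt_msBetween hr μ hε] with ω hω hA hB
  refine Tendsto.congr' (hω.mono fun a ha => (congrArg Params.varE ha).symm)
    (tendsto_order.2 ⟨fun c hc => ?_, fun c hc => ?_⟩)
  · filter_upwards [hA.eventually_const_lt hc, hB c hc] with a h1 h2
    refine lt_min h1 ?_
    rw [lt_div_iff₀ hr']
    nlinarith
  · filter_upwards [hA.eventually_lt_const hc] with a h1
    exact (min_le_left _ _).trans_lt h1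

lemma ae_tendsto_varU (h : IsRandomEffects P U ε) (hr : 2 ≤ r) (μ : ℝ)
    (hvu : 0 ≤ vu) (hve : 0 < ve) (hU : ∀ i, MemLp (U i) 2 P ∧ Var[U i; P] = vu)
    (hε : ∀ i j, MemLp (ε i j) 2 P ∧ Var[ε i j; P] = ve)
    {T : (a : ℕ) → (Fin a → Fin r → ℝ) → Params} (hT : ∀ a, IsMLEstimator (T a)) :
    ∀ᵐ ω ∂P, Tendsto (fun a => (T a (sample μ U ε a ω)).varU) atTop (𝓝 vu) := by
  have hr' : (0 : ℝ) < r := by positivity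
  filter_upwards [h.ae_eventually_eq_explicitMLE hr μ hve hε hT, h.ae_tendsto_msWithin hr μ hε,
    h.ae_tendsto_msBetween hr μ hU hε] with ω hω hA hB
  refine Tendsto.congr' (hω.mono fun a ha => (congrArg Params.varU ha).symm) ?_
  have := (tendsto_const_nhds (x := (0 : ℝ))).max ((hB.sub hA).div_const (r : ℝ))
  rwa [show (r * vu + ve - ve) / (r : ℝ) = vu by field_simp; ring, max_eq_right hvu] at this

end IsRandomEffects

end OneWay

/-! ### Gaussian moments and the independence of mean and deviations -/

namespace OneWay

section fourthMoment

variable {Ω : Type*} [MeasurableSpace Ω] {P : Measure Ω}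

/-- The fourth moment of a centred Gaussian variable is read off the fourth derivative of its
moment generating function `exp (v t² / 2)`. -/
lemma integral_pow_four_gaussianReal (v : ℝ≥0) :
    ∫ x, x ^ 4 ∂gaussianReal 0 v = 3 * (v : ℝ) ^ 2 := by
  have h0 : (0 : ℝ) ∈ interior (integrableExpSet (fun x : ℝ => x) (gaussianReal 0 v)) := by
    simp
  have h1 := iteratedDeriv_mgf_zero h0 4
  have hd : ∀ {p q : ℝ → ℝ} (p' : ℝ → ℝ), (∀ t, HasDerivAt p (p' t) t) →
      (∀ t, q t = p' t + v * t * p t) →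
      deriv (fun t => p t * Real.exp (v * t ^ 2 / 2)) = fun t => q t * Real.exp (v * t ^ 2 / 2) := by
    intro p q p' hp hq
    ext t
    have e1 : HasDerivAt (fun t : ℝ => Real.exp (v * t ^ 2 / 2))
        (Real.exp (v * t ^ 2 / 2) * (v * t)) t := by
      refine HasDerivAt.exp ?_
      convert! ((hasDerivAt_pow 2 t).const_mul (v : ℝ)).div_const 2 using 1
      simp
      ring
    rw [((hp t).fun_mul e1).deriv, hq]
    ring
  have e0 : mgf (fun x : ℝ => x) (gaussianReal 0 v)
      = fun t => 1 * Real.exp (v * t ^ 2 / 2) := by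
    rw [mgf_fun_id_gaussianReal]
    simp
  have d1 := hd (p := fun _ => 1) (q := fun t => v * t) (fun _ => 0)
    (fun t => hasDerivAt_const t 1) (fun t => by ring)
  have d2 := hd (p := fun t => v * t) (q := fun t => v + v ^ 2 * t ^ 2) _
    (fun t => (hasDerivAt_id' t).const_mul _) (fun t => by ring)
  have d3 := hd (p := fun t => v + v ^ 2 * t ^ 2) (q := fun t => 3 * v ^ 2 * t + v ^ 3 * t ^ 3) _
    (fun t => ((hasDerivAt_pow 2 t).const_mul _).const_add _) (fun t => by push_cast; ring)
  have d4 := hd (p := fun t => 3 * v ^ 2 * t + v ^ 3 * t ^ 3)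
    (q := fun t => 3 * v ^ 2 + 6 * v ^ 3 * t ^ 2 + v ^ 4 * t ^ 4) _
    (fun t => ((hasDerivAt_id' t).const_mul _).fun_add ((hasDerivAt_pow 3 t).const_mul _))
    (fun t => by push_cast; ring)
  rw [e0, iteratedDeriv_succ', iteratedDeriv_succ', iteratedDeriv_succ', iteratedDeriv_succ',
    iteratedDeriv_zero, d1, d2, d3, d4] at h1
  simpa using h1.symm

variable {X : Ω → ℝ}

lemma memLp_sq_of_hasGaussianLaw (hX : HasGaussianLaw X P) : MemLp (fun ω => X ω ^ 2) 2 P := by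
  have h4 : MemLp X 4 P := hX.memLp (by simp)
  rw [memLp_two_iff_integrable_sq (by have := hX.aemeasurable; fun_prop)]
  have := (h4.integrable_norm_pow (p := 4) (by simp))
  refine this.congr (ae_of_all _ fun ω => ?_)
  simp only [Real.norm_eq_abs]
  rw [← pow_mul, pow_abs, abs_of_nonneg (by positivity)]

/-- `Var (X²) = 2 (Var X)²` for a centred Gaussian variable. -/
lemma variance_sq_of_hasGaussianLaw (hX : HasGaussianLaw X P) (h0 : P[X] = 0) :
    Var[fun ω => X ω ^ 2; P] = 2 * Var[X; P] ^ 2 := by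
  have := hX.isProbabilityMeasure
  have hm := hX.aemeasurable
  have h2 : P[fun ω => X ω ^ 2] = Var[X; P] := (variance_of_integral_eq_zero hm h0).symm
  have h4 : P[(fun ω => X ω ^ 2) ^ 2] = 3 * Var[X; P] ^ 2 := by
    have h := integral_pow_four_gaussianReal Var[X; P].toNNReal
    rw [← h0, ← hX.map_eq_gaussianReal, integral_map hm (by fun_prop),
      Real.coe_toNNReal _ (variance_nonneg _ _)] at h
    rw [← h]
    refine integral_congr_ae (ae_of_all _ fun ω => ?_)
    simp only [Pi.pow_apply]
    ring
  rw [variance_eq_sub (memLp_sq_of_hasGaussianLaw hX), h4, h2]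
  ring

end fourthMoment

namespace IsRandomEffects

variable {Ω : Type*} [MeasurableSpace Ω] {r : ℕ} {P : Measure Ω}
  {U : ℕ → Ω → ℝ} {ε : ℕ → Fin r → Ω → ℝ} {vu ve : ℝ≥0}

lemma memLp_variance_of_hasLaw {X : Ω → ℝ} {m : ℝ} {v : ℝ≥0}
    (hX : HasLaw X (gaussianReal m v) P) : MemLp X 2 P ∧ Var[X; P] = v := by
  refine ⟨hX.hasGaussianLaw.memLp_two, ?_⟩
  rw [← variance_id_map hX.aemeasurable, hX.map_eq, variance_id_gaussianReal]

lemma integral_of_hasLaw {X : Ω → ℝ} {m : ℝ} {v : ℝ≥0}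
    (hX : HasLaw X (gaussianReal m v) P) : P[X] = m := by
  rw [← integral_id_gaussianReal (μ := m) (v := v), ← hX.map_eq,
    integral_map hX.aemeasurable (by fun_prop)]

lemma hasGaussianLaw_block (h : IsRandomEffects P U ε)
    (hU : ∀ i, HasLaw (U i) (gaussianReal 0 vu) P)
    (hε : ∀ i j, HasLaw (ε i j) (gaussianReal 0 ve) P) (i : ℕ) :
    HasGaussianLaw (fun ω k => block U ε i k ω) P := by
  refine (h.iIndepFun_block_apply i).hasGaussianLaw fun k => ?_
  cases k
  · exact (hU i).hasGaussianLaw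
  · exact (hε i _).hasGaussianLaw

/-- The mean of the errors is uncorrelated with their deviations from it. -/
lemma covariance_errorMean_deviation [IsProbabilityMeasure P] (h : IsRandomEffects P U ε)
    {v : ℝ} (hε : ∀ i j, MemLp (ε i j) 2 P ∧ Var[ε i j; P] = v) (i : ℕ) (j : Fin r) :
    cov[errorMean ε i, fun ω => ε i j ω - errorMean ε i ω; P] = 0 := by
  have hL := memLp_errorMean (fun i j => (hε i j).1) i
  have h1 : cov[errorMean ε i, ε i j; P] = v / r := by
    have e : errorMean ε i = fun ω => (∑ k, ε i k ω) / r := rfl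
    rw [e, covariance_fun_div_left, covariance_fun_sum_left (fun k => (hε i k).1) (hε i j).1,
      Finset.sum_eq_single j]
    · rw [covariance_self (hε i j).1.aemeasurable, (hε i j).2]
    · intro k _ hk
      exact ((h.iIndepFun_error i).indepFun hk).covariance_eq_zero (hε i k).1 (hε i j).1
    · simp
  rw [covariance_fun_sub_right hL (hε i j).1 hL, covariance_self hL.aemeasurable, h1,
    h.variance_errorMean hε, sub_self]

/-- In the Gaussian model `c Uᵢ + ε̄ᵢ.` is independent of the sum of squares within unit `i`. The
values of interest are `c = 0` and `c = 1`. -/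
lemma indepFun_mul_effect_add_errorMean_errorSS [IsProbabilityMeasure P]
    (h : IsRandomEffects P U ε) (hU : ∀ i, HasLaw (U i) (gaussianReal 0 vu) P)
    (hε : ∀ i j, HasLaw (ε i j) (gaussianReal 0 ve) P) (c : ℝ) (i : ℕ) :
    (fun ω => c * U i ω + errorMean ε i ω) ⟂ᵢ[P] errorSS ε i := by
  have hεm : ∀ i j, MemLp (ε i j) 2 P ∧ Var[ε i j; P] = ve :=
    fun i j => memLp_variance_of_hasLaw (hε i j)
  have hU2 := (memLp_variance_of_hasLaw (hU i)).1
  have hL := memLp_errorMean (fun i j => (hεm i j).1) i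
  let L : (Option (Fin r) → ℝ) →ₗ[ℝ] (Unit → ℝ) × (Fin r → ℝ) :=
    { toFun := fun z => (fun _ => c * z none + (∑ j, z (some j)) / r,
        fun j => z (some j) - (∑ j, z (some j)) / r)
      map_add' := fun z w => by
        ext <;> simp [Finset.sum_add_distrib] <;> ring
      map_smul' := fun s z => by
        ext <;> simp [← Finset.mul_sum] <;> ring }
  have hG : HasGaussianLaw (fun ω => ((fun _ => c * U i ω + errorMean ε i ω : Unit → ℝ),
      fun j => ε i j ω - errorMean ε i ω)) P :=
    (h.hasGaussianLaw_block hU hε i).map_fun L.toContinuousLinearMap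
  have hI := HasGaussianLaw.indepFun_of_covariance_eval
    (X := fun _ ω => c * U i ω + errorMean ε i ω) (Y := fun j ω => ε i j ω - errorMean ε i ω)
    hG fun _ j => by
      have hD : MemLp (fun ω => ε i j ω - errorMean ε i ω) 2 P := (hεm i j).1.sub hL
      have hUD : U i ⟂ᵢ[P] (fun ω => ε i j ω - errorMean ε i ω) :=
        h.indepFun_comp {i} (f := fun x => x ⟨i, by simp⟩)
          (g := fun x => x ⟨i, by simp⟩ j - (∑ j, x ⟨i, by simp⟩ j) / r)
          (by fun_prop) (by fun_prop)
      have e : (fun ω => c * U i ω + errorMean ε i ω) = (fun ω => c * U i ω) + errorMean ε i := rfl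
      rw [e, covariance_add_left (hU2.const_mul c) hL hD, covariance_const_mul_left,
        hUD.covariance_eq_zero hU2 hD, h.covariance_errorMean_deviation hεm]
      simp
  exact hI.comp (φ := fun x : Unit → ℝ => x ()) (ψ := fun d : Fin r → ℝ => ∑ j, d j ^ 2)
    (measurable_pi_apply ()) (by fun_prop)

lemma hasGaussianLaw_effect (h : IsRandomEffects P U ε)
    (hU : ∀ i, HasLaw (U i) (gaussianReal 0 vu) P)
    (hε : ∀ i j, HasLaw (ε i j) (gaussianReal 0 ve) P) (c : ℝ) (i : ℕ) :
    HasGaussianLaw (fun ω => c * U i ω + errorMean ε i ω) P := by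
  let L : (Option (Fin r) → ℝ) →ₗ[ℝ] ℝ :=
    { toFun := fun z => c * z none + (∑ j, z (some j)) / r
      map_add' := fun z w => by simp [Finset.sum_add_distrib]; ring
      map_smul' := fun s z => by simp [← Finset.mul_sum]; ring }
  exact (h.hasGaussianLaw_block hU hε i).map_fun L.toContinuousLinearMap

lemma integral_errorMean_of_hasLaw (hε : ∀ i j, HasLaw (ε i j) (gaussianReal 0 ve) P) (i : ℕ) :
    P[errorMean ε i] = 0 := by
  unfold errorMean
  rw [integral_div, integral_finsetSum _ fun j _ => (hε i j).hasGaussianLaw.integrable]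
  simp [integral_of_hasLaw (hε i _)]

lemma memLp_errorSS (hr : r ≠ 0) (hε : ∀ i j, HasLaw (ε i j) (gaussianReal 0 ve) P)
    (hm : HasGaussianLaw (errorMean ε i) P) : MemLp (errorSS ε i) 2 P := by
  have h1 : MemLp (fun ω => ∑ j, ε i j ω ^ 2) 2 P :=
    memLp_finsetSum _ fun j _ => memLp_sq_of_hasGaussianLaw (hε i j).hasGaussianLaw
  have h2 := h1.sub ((memLp_sq_of_hasGaussianLaw hm).const_mul (r : ℝ))
  exact h2.ae_eq (ae_of_all _ fun ω => (errorSS_eq hr ε i ω).symm)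

/-- The variance of the sum of squares within a unit, from the decomposition of `∑ⱼ εᵢⱼ²` into
the independent summands `errorSS ε i` and `r ε̄ᵢ.²`. -/
lemma variance_errorSS [IsProbabilityMeasure P] (h : IsRandomEffects P U ε) (hr : r ≠ 0)
    (hU : ∀ i, HasLaw (U i) (gaussianReal 0 vu) P)
    (hε : ∀ i j, HasLaw (ε i j) (gaussianReal 0 ve) P) (i : ℕ) :
    Var[errorSS ε i; P] = 2 * (r - 1) * (ve : ℝ) ^ 2 := by
  have hr' : (r : ℝ) ≠ 0 := by exact_mod_cast hr
  have hεm : ∀ i j, MemLp (ε i j) 2 P ∧ Var[ε i j; P] = ve :=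
    fun i j => memLp_variance_of_hasLaw (hε i j)
  have hG : HasGaussianLaw (errorMean ε i) P := by
    simpa using! h.hasGaussianLaw_effect hU hε 0 i
  have hind : errorMean ε i ⟂ᵢ[P] errorSS ε i := by
    simpa using! h.indepFun_mul_effect_add_errorMean_errorSS hU hε 0 i
  have hQ := memLp_errorSS hr hε hG
  have hM := (memLp_sq_of_hasGaussianLaw hG).const_mul (r : ℝ)
  have h1 : Var[fun ω => ∑ j, ε i j ω ^ 2; P] = r * (2 * (ve : ℝ) ^ 2) := by
    have e : (fun ω => ∑ j, ε i j ω ^ 2) = ∑ j, fun ω => ε i j ω ^ 2 := by ext ω; simp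
    rw [e, IndepFun.variance_sum
      (fun j _ => memLp_sq_of_hasGaussianLaw (hε i j).hasGaussianLaw)
      (fun j _ k _ hjk => ((h.iIndepFun_error i).indepFun hjk).comp (φ := fun x => x ^ 2)
        (ψ := fun x => x ^ 2) (by fun_prop) (by fun_prop))]
    simp [variance_sq_of_hasGaussianLaw (hε i _).hasGaussianLaw (integral_of_hasLaw (hε i _)),
      (hεm i _).2]
  have h2 : (fun ω => ∑ j, ε i j ω ^ 2) = fun ω => errorSS ε i ω + r * errorMean ε i ω ^ 2 := by
    ext ω
    rw [errorSS_eq hr]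
    ring
  have hind' : errorSS ε i ⟂ᵢ[P] fun ω => r * errorMean ε i ω ^ 2 :=
    hind.symm.comp (φ := id) (ψ := fun x : ℝ => (r : ℝ) * x ^ 2) measurable_id (by fun_prop)
  rw [h2, hind'.variance_fun_add hQ hM, variance_const_mul,
    variance_sq_of_hasGaussianLaw hG (integral_errorMean_of_hasLaw hε i),
    h.variance_errorMean hεm] at h1
  field_simp at h1
  linarith

end IsRandomEffects

end OneWay

/-! ### A central limit theorem in Euclidean space -/

namespace OneWay

open scoped RealInnerProductSpace in
/-- The central limit theorem in a Euclidean space. By Lévy's continuity theorem it suffices to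
apply the real central limit theorem to the inner products with each vector. -/
lemma tendstoInDistribution_multivariateGaussian {Ω ι : Type*} [MeasurableSpace Ω]
    {P : Measure Ω} [IsProbabilityMeasure P] [Fintype ι] [DecidableEq ι]
    {G : ℕ → Ω → EuclideanSpace ℝ ι} {m : EuclideanSpace ℝ ι} {S : Matrix ι ι ℝ}
    (hS : S.IsHermitian) (hindep : iIndepFun G P) (hident : ∀ i, IdentDistrib (G i) (G 0) P P)
    (hG : MemLp (G 0) 2 P) (hm : P[G 0] = m)
    (hcov : ∀ t : EuclideanSpace ℝ ι, Var[fun ω => ⟪t, G 0 ω⟫; P] = t ⬝ᵥ S.mulVec t) :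
    TendstoInDistribution
      (fun (n : ℕ) ω => (√(n : ℝ))⁻¹ • (∑ k ∈ Finset.range n, G k ω - (n : ℝ) • m)) atTop
      (id : EuclideanSpace ℝ ι → EuclideanSpace ℝ ι) (fun _ => P) (multivariateGaussian 0 S) := by
  have hS' : S.PosSemidef := by
    refine Matrix.PosSemidef.of_dotProduct_mulVec_nonneg hS fun x => ?_
    have := hcov (WithLp.toLp 2 x)
    simp only [star_trivial]
    exact (variance_nonneg _ _).trans this.le
  have hmeas : ∀ n : ℕ, AEMeasurable
      (fun ω => (√(n : ℝ))⁻¹ • (∑ k ∈ Finset.range n, G k ω - (n : ℝ) • m)) P := fun n => by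
    have := fun k => (hident k).aemeasurable_fst
    fun_prop
  refine ⟨hmeas, aemeasurable_id, ProbabilityMeasure.tendsto_iff_tendsto_charFun.2 fun t => ?_⟩
  have hmem : MemLp (fun ω => ⟪t, G 0 ω⟫) 2 P := hG.const_inner t
  have hclt := tendstoInDistribution_inv_sqrt_mul_sum_sub (P := P)
    (X := fun k ω => ⟪t, G k ω⟫) (Y := id) HasLaw.id hmem
    (hindep.comp (fun _ x => ⟪t, x⟫) fun _ => by fun_prop)
    (fun i => (hident i).comp (u := fun x => ⟪t, x⟫) (by fun_prop))
  have h1 := ProbabilityMeasure.tendsto_iff_tendsto_charFun.1 hclt.tendsto 1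
  have hmean : ∫ ω, ⟪t, G 0 ω⟫ ∂P = ⟪t, m⟫ := by
    rw [integral_inner (hG.integrable one_le_two), hm]
  have hmeas' := hclt.forall_aemeasurable
  simp only [hmean] at hmeas'
  simp only [ProbabilityMeasure.coe_mk, Measure.map_id, charFun_gaussianReal, hcov,
    hmean] at h1
  simp only [ProbabilityMeasure.coe_mk, Measure.map_id, charFun_multivariateGaussian hS']
  convert! h1 using 2 with n
  · rw [charFun_apply, charFun_apply_real, integral_map (hmeas n) (by fun_prop),
      integral_map (hmeas' n) (by fun_prop)]
    congr 1
    ext ω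
    congr 2
    simp only [Complex.ofReal_one, one_mul]
    rw [real_inner_comm, real_inner_smul_right, inner_sub_right, inner_sum, real_inner_smul_right]
  · have : 0 ≤ t ⬝ᵥ S.mulVec t := by rw [← hcov]; exact variance_nonneg _ _
    rw [Real.coe_toNNReal _ this]
    simp

end OneWay

/-! ### Asymptotic normality -/

namespace OneWay

section unitStat

variable {Ω : Type*} {r : ℕ}

/-- The contribution of unit `i` to the pair of variance estimators, up to the correction for the
estimated mean: its components have the expectations `σ²_ε` and `σ²_u`. -/
noncomputable def unitStat (U : ℕ → Ω → ℝ) (ε : ℕ → Fin r → Ω → ℝ) (i : ℕ) (ω : Ω) :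
    EuclideanSpace ℝ (Fin 2) :=
  !₂[errorSS ε i ω / (r - 1), (U i ω + errorMean ε i ω) ^ 2 - errorSS ε i ω / (r * (r - 1))]

/-- Where the constraint `0 ≤ σ²_u` is not active, the normalized error of the estimators is a
normalized sum over the units, up to the squared overall mean in the second component. -/
lemma sqrt_smul_explicitMLE_sub (hr : 2 ≤ r) (μ : ℝ) (U : ℕ → Ω → ℝ) (ε : ℕ → Fin r → Ω → ℝ)
    (vu ve : ℝ) {a : ℕ} (ha : 0 < a) {ω : Ω}
    (hle : msWithin (sample μ U ε a ω) ≤ msBetween (sample μ U ε a ω)) :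
    √(a : ℝ) • !₂[(explicitMLE (sample μ U ε a ω)).varE - ve,
        (explicitMLE (sample μ U ε a ω)).varU - vu]
      = (√(a : ℝ))⁻¹ • (∑ k ∈ Finset.range a, unitStat U ε k ω - (a : ℝ) • !₂[ve, vu])
        + (√(a : ℝ) * ((∑ k ∈ Finset.range a, (U k ω + errorMean ε k ω)) / a) ^ 2)
          • !₂[(0 : ℝ), -1] := by
  have hr0 : r ≠ 0 := by omega
  have hr' : (0 : ℝ) < r := by positivity
  have hr1 : (r : ℝ) - 1 ≠ 0 := by
    have : (2 : ℝ) ≤ r := by exact_mod_cast hr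
    linarith
  have ha' : (0 : ℝ) < a := by exact_mod_cast ha
  have hs : √(a : ℝ) ≠ 0 := (Real.sqrt_pos.2 ha').ne'
  have hsa : (√(a : ℝ))⁻¹ = √(a : ℝ) / a := by
    rw [inv_eq_iff_eq_inv, inv_div, eq_div_iff hs, Real.mul_self_sqrt ha'.le]
  have hE : (explicitMLE (sample μ U ε a ω)).varE = msWithin (sample μ U ε a ω) := by
    refine min_eq_left ?_
    rw [le_div_iff₀ hr']
    linarith
  have hU : (explicitMLE (sample μ U ε a ω)).varU
      = (msBetween (sample μ U ε a ω) - msWithin (sample μ U ε a ω)) / r :=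
    max_eq_right (div_nonneg (sub_nonneg.2 hle) hr'.le)
  rw [hE, hU, msWithin_sample hr0, msBetween_sample hr0, sampleVar_eq, hsa]
  ext k
  fin_cases k
  · simp [unitStat, ← Finset.sum_div]
    field_simp
  · simp [unitStat, ← Finset.sum_div]
    field_simp
    ring

end unitStat

namespace IsRandomEffects

variable {Ω : Type*} [MeasurableSpace Ω] {r : ℕ} {P : Measure Ω}
  {U : ℕ → Ω → ℝ} {ε : ℕ → Fin r → Ω → ℝ} {vu ve : ℝ≥0}

/-- Measurability of `unitStat` as a function of the variables of the unit. -/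
lemma measurable_unitStat_fun (r : ℕ) : Measurable (fun z : Option (Fin r) → ℝ =>
    (!₂[(∑ j, (z (some j) - (∑ j, z (some j)) / r) ^ 2) / ((r : ℝ) - 1),
      (z none + (∑ j, z (some j)) / r) ^ 2
        - (∑ j, (z (some j) - (∑ j, z (some j)) / r) ^ 2) / ((r : ℝ) * (r - 1))] :
      EuclideanSpace ℝ (Fin 2))) := by
  refine (WithLp.measurable_toLp 2 _).comp (measurable_pi_lambda _ fun k => ?_)
  fin_cases k
  · simp only [Fin.zero_eta, Matrix.cons_val_zero]; fun_prop
  · simp only [Fin.mk_one, Matrix.cons_val_one, Matrix.cons_val_fin_one]; fun_prop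

lemma iIndepFun_unitStat (h : IsRandomEffects P U ε) : iIndepFun (unitStat U ε) P :=
  h.iIndepFun_comp_block (measurable_unitStat_fun r)

lemma identDistrib_unitStat (h : IsRandomEffects P U ε) (i i' : ℕ) :
    IdentDistrib (unitStat U ε i) (unitStat U ε i') P P :=
  h.identDistrib_comp_block (measurable_unitStat_fun r) i i'

lemma measurable_explicitMLE_sample (h : IsRandomEffects P U ε) (hr : r ≠ 0) (μ : ℝ) (a : ℕ) :
    Measurable (fun ω => (explicitMLE (sample μ U ε a ω)).varE) ∧
      Measurable (fun ω => (explicitMLE (sample μ U ε a ω)).varU) := by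
  have hW : Measurable (fun ω => msWithin (sample μ U ε a ω)) := by
    simp only [msWithin_sample hr]
    have := h.measurable_errorSS
    fun_prop
  have hB : Measurable (fun ω => msBetween (sample μ U ε a ω)) := by
    simp only [msBetween_sample hr, sampleVar]
    have := h.measurable_errorMean
    have := h.measurable_U
    fun_prop
  constructor
  · unfold explicitMLE
    fun_prop
  · unfold explicitMLE
    fun_prop

variable [IsProbabilityMeasure P]

/-- There is variation within units almost surely, if the errors are Gaussian: the difference of
two errors in a unit has no atom at `0`. -/
lemma ae_msWithin_pos (h : IsRandomEffects P U ε) (hr : 2 ≤ r) (hve : 0 < ve) (μ : ℝ)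
    (hε : ∀ i j, HasLaw (ε i j) (gaussianReal 0 ve) P) {a : ℕ} (ha : 0 < a) :
    ∀ᵐ ω ∂P, 0 < msWithin (sample μ U ε a ω) := by
  have hr1 : (0 : ℝ) < r - 1 := by
    have : (2 : ℝ) ≤ r := by exact_mod_cast hr
    linarith
  have ha' : (0 : ℝ) < a := by exact_mod_cast ha
  obtain ⟨j, hj⟩ : ∃ j, j = (⟨0, by omega⟩ : Fin r) := ⟨_, rfl⟩
  obtain ⟨k, hk⟩ : ∃ k, k = (⟨1, by omega⟩ : Fin r) := ⟨_, rfl⟩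
  have hjk : j ≠ k := by rw [hj, hk]; simp
  have hind := (h.iIndepFun_error 0).indepFun hjk
  have hj2 := memLp_variance_of_hasLaw (hε 0 j)
  have hk2 := memLp_variance_of_hasLaw (hε 0 k)
  have hG : HasGaussianLaw (fun ω => ε 0 j ω - ε 0 k ω) P :=
    (hind.hasGaussianLaw (hε 0 j).hasGaussianLaw (hε 0 k).hasGaussianLaw).fun_sub
  have hv : Var[fun ω => ε 0 j ω - ε 0 k ω; P] = 2 * ve := by
    rw [variance_fun_sub hj2.1 hk2.1, hind.covariance_eq_zero hj2.1 hk2.1, hj2.2, hk2.2]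
    ring
  have hne : ∀ᵐ ω ∂P, ε 0 j ω - ε 0 k ω ≠ 0 := by
    have hv0 : (2 * (ve : ℝ)).toNNReal ≠ 0 := by
      have : (0 : ℝ) < ve := hve
      exact (Real.toNNReal_pos.2 (by positivity)).ne'
    have := nullSingletonClass_gaussianReal (μ := P[fun ω => ε 0 j ω - ε 0 k ω]) hv0
    rw [← hv, ← hG.map_eq_gaussianReal] at this
    refine ae_of_ae_map hG.aemeasurable (p := fun x => x ≠ 0) ?_
    rw [ae_iff]
    simp
  filter_upwards [hne] with ω hω
  rw [msWithin_sample (by omega)]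
  have hnn : ∀ i, 0 ≤ errorSS ε i ω := fun i => Finset.sum_nonneg fun j _ => sq_nonneg _
  have h0 : 0 < errorSS ε 0 ω := by
    refine (hnn 0).lt_of_ne' fun h0 => hω ?_
    have := (Finset.sum_eq_zero_iff_of_nonneg fun j _ => sq_nonneg _).1 h0
    have e1 := pow_eq_zero_iff (two_ne_zero) |>.1 (this j (Finset.mem_univ _))
    have e2 := pow_eq_zero_iff (two_ne_zero) |>.1 (this k (Finset.mem_univ _))
    linarith
  have : 0 < ∑ i ∈ Finset.range a, errorSS ε i ω :=
    Finset.sum_pos' (fun i _ => hnn i) ⟨0, Finset.mem_range.2 ha, h0⟩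
  positivity

/-- An estimator need not be measurable, but it agrees with the closed form almost surely. -/
lemma aemeasurable_estimator (h : IsRandomEffects P U ε) (hr : 2 ≤ r) (hve : 0 < ve) (μ : ℝ)
    (hε : ∀ i j, HasLaw (ε i j) (gaussianReal 0 ve) P)
    {T : (a : ℕ) → (Fin a → Fin r → ℝ) → Params} (hT : ∀ a, IsMLEstimator (T a)) (a : ℕ) :
    AEMeasurable (fun ω => √(a : ℝ) • (!₂[(T a (sample μ U ε a ω)).varE - (ve : ℝ),
      (T a (sample μ U ε a ω)).varU - (vu : ℝ)] : EuclideanSpace ℝ (Fin 2))) P := by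
  rcases a.eq_zero_or_pos with rfl | ha
  · simp
  obtain ⟨hE, hU⟩ := h.measurable_explicitMLE_sample (by omega) μ a
  have hm : Measurable (fun ω =>
      √(a : ℝ) • (!₂[(explicitMLE (sample μ U ε a ω)).varE - (ve : ℝ),
        (explicitMLE (sample μ U ε a ω)).varU - (vu : ℝ)] : EuclideanSpace ℝ (Fin 2))) := by
    refine Measurable.fun_const_smul ?_ _
    refine (WithLp.measurable_toLp 2 _).comp (measurable_pi_lambda _ fun k => ?_)
    fin_cases k
    · exact hE.sub_const _
    · exact hU.sub_const _
  refine hm.aemeasurable.congr ?_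
  filter_upwards [h.ae_msWithin_pos hr hve μ hε ha] with ω hω
  rw [(hT a).eq_explicitMLE ha hr hω]

lemma integral_effect (hU : ∀ i, HasLaw (U i) (gaussianReal 0 vu) P)
    (hε : ∀ i j, HasLaw (ε i j) (gaussianReal 0 ve) P) (i : ℕ) :
    ∫ ω, (U i ω + errorMean ε i ω) ∂P = 0 := by
  have h1 := (memLp_variance_of_hasLaw (hU i)).1.integrable one_le_two
  have h2 := (memLp_errorMean (fun i j => (memLp_variance_of_hasLaw (hε i j)).1) i).integrable
    one_le_two
  rw [integral_add h1 h2, integral_of_hasLaw (hU i), integral_errorMean_of_hasLaw hε, add_zero]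

/-- The squared overall mean is of order `1 / a`, so negligible against `1 / √a`. -/
lemma tendstoInMeasure_sqrt_mul_mean_sq (h : IsRandomEffects P U ε)
    (hU : ∀ i, HasLaw (U i) (gaussianReal 0 vu) P)
    (hε : ∀ i j, HasLaw (ε i j) (gaussianReal 0 ve) P) :
    TendstoInMeasure P (fun (a : ℕ) ω =>
      √(a : ℝ) * ((∑ k ∈ Finset.range a, (U k ω + errorMean ε k ω)) / a) ^ 2) atTop
      (fun _ => (0 : ℝ)) := by
  have hUm : ∀ i, MemLp (U i) 2 P ∧ Var[U i; P] = vu := fun i => memLp_variance_of_hasLaw (hU i)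
  have hεm : ∀ i j, MemLp (ε i j) 2 P ∧ Var[ε i j; P] = ve :=
    fun i j => memLp_variance_of_hasLaw (hε i j)
  have hV := memLp_effect (fun i => (hUm i).1) (fun i j => (hεm i j).1)
  have hS : ∀ a : ℕ, MemLp (fun ω => ∑ k ∈ Finset.range a, (U k ω + errorMean ε k ω)) 2 P :=
    fun a => memLp_finsetSum _ fun k _ => hV k
  have hS2 : ∀ a : ℕ, ∫ ω, (∑ k ∈ Finset.range a, (U k ω + errorMean ε k ω)) ^ 2 ∂P
      = a * (vu + ve / r) := by
    intro a
    rw [← variance_of_integral_eq_zero (hS a).aemeasurable]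
    · have e : (fun ω => ∑ k ∈ Finset.range a, (U k ω + errorMean ε k ω))
          = ∑ k ∈ Finset.range a, fun ω => U k ω + errorMean ε k ω := by ext ω; simp
      rw [e, IndepFun.variance_sum (fun k _ => hV k)
        (fun j _ k _ hjk => h.iIndepFun_effect.indepFun hjk)]
      simp only [h.variance_effect hUm hεm, Finset.sum_const, Finset.card_range, nsmul_eq_mul]
    · rw [integral_finsetSum _ fun k _ => (hV k).integrable one_le_two]
      simp [integral_effect hU hε]
  have hint : ∀ a : ℕ, Integrable (fun ω =>
      √(a : ℝ) * ((∑ k ∈ Finset.range a, (U k ω + errorMean ε k ω)) / a) ^ 2) P := fun a => by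
    simp only [div_pow]
    exact ((hS a).integrable_sq.div_const _).const_mul _
  refine tendstoInMeasure_of_tendsto_eLpNorm one_ne_zero (fun a => (hint a).aestronglyMeasurable)
    aestronglyMeasurable_const ?_
  have hval : ∀ a : ℕ, eLpNorm ((fun ω =>
      √(a : ℝ) * ((∑ k ∈ Finset.range a, (U k ω + errorMean ε k ω)) / a) ^ 2) - fun _ => (0 : ℝ))
      1 P = ENNReal.ofReal ((√(a : ℝ))⁻¹ * (vu + ve / r)) := by
    intro a
    have e0 : ((fun ω => √(a : ℝ) * ((∑ k ∈ Finset.range a, (U k ω + errorMean ε k ω)) / a) ^ 2)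
        - fun _ => (0 : ℝ)) = fun ω =>
          √(a : ℝ) * ((∑ k ∈ Finset.range a, (U k ω + errorMean ε k ω)) / a) ^ 2 := by
      ext ω
      simp
    rw [e0, eLpNorm_one_eq_lintegral_enorm, ← ofReal_integral_norm_eq_lintegral_enorm (hint a)]
    congr 1
    have e1 : ∀ ω, ‖√(a : ℝ) * ((∑ k ∈ Finset.range a, (U k ω + errorMean ε k ω)) / a) ^ 2‖
        = √(a : ℝ) / (a : ℝ) ^ 2 * (∑ k ∈ Finset.range a, (U k ω + errorMean ε k ω)) ^ 2 := by
      intro ω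
      rw [Real.norm_of_nonneg (by positivity)]
      ring
    simp only [e1]
    rw [integral_const_mul, hS2]
    rcases a.eq_zero_or_pos with rfl | ha
    · simp
    have ha' : (0 : ℝ) < a := by exact_mod_cast ha
    have hs : √(a : ℝ) ≠ 0 := (Real.sqrt_pos.2 ha').ne'
    field_simp
    rw [Real.sq_sqrt ha'.le]
  simp only [hval]
  rw [← ENNReal.ofReal_zero]
  refine ENNReal.tendsto_ofReal ?_
  have := (tendsto_inv_atTop_zero.comp <| Real.tendsto_sqrt_atTop.comp <|
    tendsto_natCast_atTop_atTop (R := ℝ)).mul_const ((vu : ℝ) + ve / r)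
  simpa using! this

open scoped RealInnerProductSpace in
/-- The central limit theorem for the sum of the contributions of the units. -/
lemma tendstoInDistribution_sum_unitStat (h : IsRandomEffects P U ε) (hr : 2 ≤ r)
    (hU : ∀ i, HasLaw (U i) (gaussianReal 0 vu) P)
    (hε : ∀ i j, HasLaw (ε i j) (gaussianReal 0 ve) P) :
    TendstoInDistribution (fun (a : ℕ) ω => (√(a : ℝ))⁻¹ •
        (∑ k ∈ Finset.range a, unitStat U ε k ω - (a : ℝ) • !₂[(ve : ℝ), (vu : ℝ)])) atTop
      (id : EuclideanSpace ℝ (Fin 2) → EuclideanSpace ℝ (Fin 2)) (fun _ => P)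
      (multivariateGaussian 0 (asympCov r vu ve)) := by
  have hr0 : r ≠ 0 := by omega
  have hr' : (r : ℝ) ≠ 0 := by exact_mod_cast hr0
  have hr1 : (r : ℝ) - 1 ≠ 0 := by
    have : (2 : ℝ) ≤ r := by exact_mod_cast hr
    linarith
  have hUm : ∀ i, MemLp (U i) 2 P ∧ Var[U i; P] = vu := fun i => memLp_variance_of_hasLaw (hU i)
  have hεm : ∀ i j, MemLp (ε i j) 2 P ∧ Var[ε i j; P] = ve :=
    fun i j => memLp_variance_of_hasLaw (hε i j)
  have hGm : HasGaussianLaw (errorMean ε 0) P := by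
    simpa using! h.hasGaussianLaw_effect hU hε 0 0
  have hGV : HasGaussianLaw (fun ω => U 0 ω + errorMean ε 0 ω) P := by
    simpa using! h.hasGaussianLaw_effect hU hε 1 0
  have hind : (fun ω => U 0 ω + errorMean ε 0 ω) ⟂ᵢ[P] errorSS ε 0 := by
    simpa using! h.indepFun_mul_effect_add_errorMean_errorSS hU hε 1 0
  have hQ := memLp_errorSS hr0 hε hGm
  have hV2 := memLp_sq_of_hasGaussianLaw hGV
  have hVarV := variance_sq_of_hasGaussianLaw hGV (integral_effect hU hε 0)
  rw [h.variance_effect hUm hεm] at hVarV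
  have hEV : ∫ ω, (U 0 ω + errorMean ε 0 ω) ^ 2 ∂P = vu + ve / r := by
    rw [← h.variance_effect hUm hεm 0]
    exact (variance_of_integral_eq_zero hGV.aemeasurable (integral_effect hU hε 0)).symm
  have hQd : ∀ c : ℝ, MemLp (fun ω => errorSS ε 0 ω / c) 2 P := fun c => by
    simpa only [div_eq_mul_inv] using hQ.mul_const c⁻¹
  have hEQ := h.integral_errorSS hr0 hεm 0
  have hG : MemLp (unitStat U ε 0) 2 P := by
    refine MemLp.of_eval_piLp fun k => ?_
    fin_cases k
    · exact hQd _
    · exact hV2.sub (hQd _)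
  refine tendstoInDistribution_multivariateGaussian ?_ h.iIndepFun_unitStat
    (fun i => h.identDistrib_unitStat i 0) hG ?_ fun t => ?_
  · ext i j
    fin_cases i <;> fin_cases j <;> rfl
  · ext k
    rw [eval_integral_piLp fun k => (hG.eval_piLp k).integrable one_le_two]
    fin_cases k
    · change ∫ ω, errorSS ε 0 ω / (r - 1) ∂P = (ve : ℝ)
      rw [integral_div, hEQ, mul_div_cancel_left₀ _ hr1]
    · change ∫ ω, ((U 0 ω + errorMean ε 0 ω) ^ 2 - errorSS ε 0 ω / (r * (r - 1))) ∂P = (vu : ℝ)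
      rw [integral_sub (hV2.integrable one_le_two) ((hQd _).integrable one_le_two), hEV,
        integral_div, hEQ]
      field_simp
      ring
  · have e : (fun ω => ⟪t, unitStat U ε 0 ω⟫)
        = fun ω => t 1 * (U 0 ω + errorMean ε 0 ω) ^ 2
          + (t 0 / (r - 1) - t 1 / (r * (r - 1))) * errorSS ε 0 ω := by
      ext ω
      simp [unitStat, PiLp.inner_apply, Fin.sum_univ_two]
      ring
    have hind' : (fun ω => t 1 * (U 0 ω + errorMean ε 0 ω) ^ 2)
        ⟂ᵢ[P] fun ω => (t 0 / (r - 1) - t 1 / (r * (r - 1))) * errorSS ε 0 ω :=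
      hind.comp (φ := fun x : ℝ => t 1 * x ^ 2)
        (ψ := fun x : ℝ => (t 0 / (r - 1) - t 1 / (r * (r - 1))) * x) (by fun_prop) (by fun_prop)
    rw [e, hind'.variance_fun_add (hV2.const_mul _) (hQ.const_mul _), variance_const_mul,
      variance_const_mul, hVarV, h.variance_errorSS hr0 hU hε]
    simp only [asympCov, Matrix.mulVec, dotProduct, Fin.sum_univ_two, Matrix.of_apply,
      Matrix.cons_val_zero, Matrix.cons_val_one, Matrix.cons_val_fin_one]
    field_simp
    ring

lemma tendstoInDistribution_estimator (h : IsRandomEffects P U ε) (hr : 2 ≤ r) (μ : ℝ)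
    (hve : 0 < ve) (hvu : 0 < vu) (hU : ∀ i, HasLaw (U i) (gaussianReal 0 vu) P)
    (hε : ∀ i j, HasLaw (ε i j) (gaussianReal 0 ve) P)
    {T : (a : ℕ) → (Fin a → Fin r → ℝ) → Params} (hT : ∀ a, IsMLEstimator (T a)) :
    TendstoInDistribution
      (fun (a : ℕ) (ω : Ω) =>
        √(a : ℝ) • !₂[(T a (sample μ U ε a ω)).varE - (ve : ℝ),
          (T a (sample μ U ε a ω)).varU - (vu : ℝ)])
      atTop (id : EuclideanSpace ℝ (Fin 2) → EuclideanSpace ℝ (Fin 2)) (fun _ => P)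
      (multivariateGaussian 0 (asympCov r vu ve)) := by
  have hr' : (0 : ℝ) < r := by positivity
  have hUm : ∀ i, MemLp (U i) 2 P ∧ Var[U i; P] = vu := fun i => memLp_variance_of_hasLaw (hU i)
  have hεm : ∀ i j, MemLp (ε i j) 2 P ∧ Var[ε i j; P] = ve :=
    fun i j => memLp_variance_of_hasLaw (hε i j)
  have hmeanMeas : ∀ a : ℕ, AEMeasurable (fun ω =>
      √(a : ℝ) * ((∑ k ∈ Finset.range a, (U k ω + errorMean ε k ω)) / a) ^ 2) P := fun a => by
    have := h.measurable_U
    have := h.measurable_errorMean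
    fun_prop
  have hlin := (h.tendstoInDistribution_sum_unitStat hr hU hε)
    |>.continuous_comp_prodMk_of_tendstoInMeasure_const
      (g := fun x : EuclideanSpace ℝ (Fin 2) × ℝ => x.1 + x.2 • !₂[(0 : ℝ), -1]) (by fun_prop)
      (h.tendstoInMeasure_sqrt_mul_mean_sq hU hε) hmeanMeas
  simp only [id, zero_smul, add_zero] at hlin
  have hTm := h.aemeasurable_estimator (vu := vu) hr hve μ hε hT
  refine tendstoInDistribution_of_tendstoInMeasure_sub _ _ hlin ?_ hTm
  refine tendstoInMeasure_of_tendsto_ae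
    (fun a => ((hTm a).sub (hlin.forall_aemeasurable a)).aestronglyMeasurable) ?_
  filter_upwards [h.ae_eventually_eq_explicitMLE hr μ hve hεm hT, h.ae_tendsto_msWithin hr μ hεm,
    h.ae_tendsto_msBetween hr μ hUm hεm] with ω hω hA hB
  refine tendsto_const_nhds.congr' ?_
  -- as `vu > 0`, the limits of the mean squares are strictly ordered
  have hlt : (ve : ℝ) < r * vu + ve := by
    have : (0 : ℝ) < vu := hvu
    have := mul_pos hr' this
    linarith
  filter_upwards [hω, hA.eventually_lt hB hlt, eventually_gt_atTop 0] with a h1 h2 h3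
  have := sqrt_smul_explicitMLE_sub hr μ U ε vu ve h3 h2.le
  simp only [Pi.sub_apply, Pi.zero_apply]
  rw [h1, this, sub_self]

end IsRandomEffects

end OneWay

theorem theorem1 {Ω : Type*} [MeasurableSpace Ω] (P : Measure Ω) [IsProbabilityMeasure P]
    (r : ℕ) (hr : 2 ≤ r) (μ : ℝ)
    (U : ℕ → Ω → ℝ) (ε : ℕ → Fin r → Ω → ℝ) (hUε : OneWay.IsRandomEffects P U ε)
    -- the true variance components
    (vu ve : ℝ≥0) (hve : 0 < ve)
    -- a maximum likelihood estimator for each number `a` of units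
    (T : (a : ℕ) → (Fin a → Fin r → ℝ) → OneWay.Params)
    (hT : ∀ a, OneWay.IsMLEstimator (T a)) :
    -- strong consistency for the error variance; no moment condition on the `U i`
    ((∀ i j, MemLp (ε i j) 2 P ∧ Var[ε i j; P] = ve) →
      ∀ᵐ ω ∂P, Tendsto (fun a => (T a (OneWay.sample μ U ε a ω)).varE) atTop (𝓝 (ve : ℝ))) ∧
    -- strong consistency for the unit variance
    ((∀ i, MemLp (U i) 2 P ∧ Var[U i; P] = vu) →
      (∀ i j, MemLp (ε i j) 2 P ∧ Var[ε i j; P] = ve) →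
      ∀ᵐ ω ∂P, Tendsto (fun a => (T a (OneWay.sample μ U ε a ω)).varU) atTop (𝓝 (vu : ℝ))) ∧
    -- joint asymptotic normality
    ((∀ i, HasLaw (U i) (gaussianReal 0 vu) P) →
      (∀ i j, HasLaw (ε i j) (gaussianReal 0 ve) P) →
      0 < vu →
      TendstoInDistribution
        (fun (a : ℕ) (ω : Ω) =>
          √(a : ℝ) • !₂[(T a (OneWay.sample μ U ε a ω)).varE - (ve : ℝ),
            (T a (OneWay.sample μ U ε a ω)).varU - (vu : ℝ)])
        atTop (id : EuclideanSpace ℝ (Fin 2) → EuclideanSpace ℝ (Fin 2)) (fun _ => P)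
        (multivariateGaussian 0 (OneWay.asympCov r vu ve))) := by
  exact ⟨fun hε => hUε.ae_tendsto_varE hr μ hve hε hT,
    fun hU hε => hUε.ae_tendsto_varU hr μ vu.2 hve hU hε hT,
    fun hU hε hvu => hUε.tendstoInDistribution_estimator hr μ hve hvu hU hε hT⟩
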